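/- Set $\delta_0=\frac14-\frac{2}{\pi^2}$ and $\delta_1=\frac1{18}$. For sets $A,B$ of positive integers write $A+B=\{a+b: a\in A,\ b\in B\}$ (equal summands are allowed), and say that a set $S$ of positive integers has density $d$ if $\lim_{N\to\infty}|S\cap[1,N]|/N$ exists and equals $d$. For every $\epsilon>0$ there exists $x_0$ such that for all real $x>x_0$ statements (i) and (ii) hold, and for every $\epsilon>0$ statement (iii) holds. (i) Let $A\subseteq[1,x]$ be a set of integers such that $A+A$ contains no squarefree integer. If $|A|>(\delta_1+\epsilon)x$, then every element of $A$ is divisible by $4$, or every element of $A$ is divisible by $9$, or every element of $A$ is congruent to $2$ modulo $4$. (ii) Let $A\subseteq[1,x]$ be a set of integers such that $A+A$ contains no squarefree integer. If $|A|>(\delta_0+\epsilon)x$, then either $A$ satisfies the conclusion of (i), or all elements of $A$ are even and there exists $a\in\{1,\dots,8\}$ such that for every $n\in A$ $$n\equiv 2\pmod 4\iff n\equiv a\pmod 9,\qquad n\equiv 0\pmod 4\iff n\equiv -a\pmod 9.$$ (iii) There exists a set $A$ of positive integers which has a density, this density being $>\delta_0-\epsilon$, such that $A+A$ contains no squarefree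 integer, $A+A+A$ contains all but finitely many positive integers, and the set of non-squarefree positive integers not contained in $A+A$ has a density, which is at most $\epsilon$. -/

import Mathlib

open Filter Topology
open scoped Pointwise

noncomputable section

/-- The constant `δ₀ = 1/4 - 2/π²`. -/
def delta0 : ℝ := 1 / 4 - 2 / Real.pi ^ 2

/-- The constant `δ₁ = 1/18`. -/
def delta1 : ℝ := 1 / 18

/-- `S` has natural density `d`: the limit of `|S ∩ [1, N]| / N` exists and equals `d`. -/
def HasNatDensity (S : Set ℕ) (d : ℝ) : Prop :=
  Tendsto (fun N : ℕ => ((S ∩ Set.Icc 1 N).ncard : ℝ) / (N : ℝ)) atTop (𝓝 d)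

/-- `A` is contained in `4ℕ`, in `9ℕ`, or in `4ℕ + 2`. -/
def IsOfTrivialType (A : Finset ℕ) : Prop :=
  (∀ n ∈ A, 4 ∣ n) ∨ (∀ n ∈ A, 9 ∣ n) ∨ (∀ n ∈ A, n ≡ 2 [MOD 4])

/-- All elements of `A` are even and, for some `a ∈ {1, …, 8}`, each `n ∈ A` satisfies
`n ≡ 2 (mod 4) ↔ n ≡ a (mod 9)` and `n ≡ 0 (mod 4) ↔ n ≡ -a (mod 9)`. -/
def IsOfTwoClassType (A : Finset ℕ) : Prop :=
  (∀ n ∈ A, Even n) ∧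
    ∃ a ∈ Finset.Icc (1 : ℤ) 8, ∀ n ∈ A,
      (((n : ℤ) ≡ 2 [ZMOD 4]) ↔ ((n : ℤ) ≡ a [ZMOD 9])) ∧
      (((n : ℤ) ≡ 0 [ZMOD 4]) ↔ ((n : ℤ) ≡ -a [ZMOD 9]))

end

/-! ### The Euler product of `ζ(2)` -/

/-! Write Q = 8/π², so that δ₀ = (1 - Q)/4. Fix a large K, let V be the product of the squares of
the odd primes up to K, and view each integer through its class modulo 4 and its residues modulo the
squares dividing V. A non-squarefree sum n + m divisible neither by 4 nor by q² for an odd prime q ≤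
K is divisible by the square of a prime above K; for fixed m this affects at most a proportion about
1/K of the n in a class modulo 4V. So, up to a negligible part, A lies in classes whose sums with
elements of A, when nonzero modulo 4, always vanish modulo some q² dividing V
(`card_le_sum_card_residueCore`). Let C j collect these classes over j modulo 4; it remains to show
that ∑ |C j| ≤ (1 - Q)V + 3 outside the listed configurations (`IsResidueCore.sum_card_le`).

Call the elements of A outside the class -j modulo 4 the partners of C j. A single partner confines
C j to a proportion 1 - Q. If the partners take two values modulo p², one that does not cancel
modulo p² can always be selected, and the proportion falls to 1 - Q/(1 - 1/p²). When this happens at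
3, 5 and 7 simultaneously, it falls below 0.0455, and four such classes are too few. If instead, for
j = 0 or 2, the partners agree modulo p², then all classes other than j lie in one residue class
modulo p², and they cost less than what C j loses at the first prime where the partners differ. The
only surviving obstruction is modulo 9, with opposite nonzero residues in the classes 0 and 2 modulo
4 and no odd elements: this is the two-class type. It occupies two classes modulo 36, hence density
at most 1/18 = δ₁ > δ₀, and (i) follows from (ii).

For (iii), take V, 2V, 3V together with the multiples n of 4 for which n + V, n + 2V, n + 3V are all
non-squarefree. Since V ≡ 1 modulo 4, the three shifts reach every nonzero class modulo 4, and every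
multiple of 4 divisible by some q² dividing V qualifies. Densities exist because the sets are limits
of periodic ones. -/

theorem tendsto_prod_primesBelow_one_sub_inv_sq :
    Tendsto (fun n : ℕ => ∏ p ∈ n.primesBelow, (1 - 1 / (p : ℝ) ^ 2)) atTop
      (𝓝 (6 / Real.pi ^ 2)) := by
  let f : ℕ →*₀ ℝ :=
    { toFun := fun n => 1 / (n : ℝ) ^ 2
      map_zero' := by simp
      map_one' := by simp
      map_mul' := fun a b => by push_cast; rw [mul_pow, one_div_mul_one_div] }
  have hs : Summable fun n => ‖f n‖ := by
    refine hasSum_zeta_two.summable.congr fun n => ?_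
    change 1 / (n : ℝ) ^ 2 = ‖1 / (n : ℝ) ^ 2‖
    rw [Real.norm_of_nonneg (by positivity)]
  have h := EulerProduct.eulerProduct_completely_multiplicative hs
  have ht : ∑' n, f n = Real.pi ^ 2 / 6 := hasSum_zeta_two.tsum_eq
  rw [ht] at h
  have h2 := h.inv₀ (by positivity)
  rw [inv_div] at h2
  refine h2.congr fun n => ?_
  rw [← Finset.prod_inv_distrib]
  refine Finset.prod_congr rfl fun p _ => ?_
  rw [inv_inv]
  rfl

theorem one_sub_one_div_sq_pos {q : ℕ} (hq : q.Prime) : (0 : ℝ) < 1 - 1 / (q : ℝ) ^ 2 := by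
  have : (2 : ℝ) ≤ q := by exact_mod_cast hq.two_le
  rw [sub_pos, div_lt_one (by positivity)]
  nlinarith

theorem one_sub_one_div_sq_le_one (q : ℕ) : 1 - 1 / (q : ℝ) ^ 2 ≤ 1 := by
  have : (0 : ℝ) ≤ 1 / (q : ℝ) ^ 2 := by positivity
  linarith

/-- All factors lie in (0, 1], so a finite product over primes only decreases towards its limit when
further primes are added. -/
theorem le_prod_primes_one_sub_inv_sq (P : Finset ℕ) (hP : ∀ p ∈ P, p.Prime) :
    6 / Real.pi ^ 2 ≤ ∏ p ∈ P, (1 - 1 / (p : ℝ) ^ 2) := by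
  refine le_of_tendsto tendsto_prod_primesBelow_one_sub_inv_sq ?_
  filter_upwards [eventually_gt_atTop (P.sup id)] with n hn
  have hsub : P ⊆ n.primesBelow := fun p hp => by
    rw [Nat.mem_primesBelow]
    exact ⟨lt_of_le_of_lt (Finset.le_sup (f := id) hp) hn, hP p hp⟩
  rw [← Finset.prod_sdiff hsub]
  refine mul_le_of_le_one_left
    (Finset.prod_nonneg fun p hp => (one_sub_one_div_sq_pos (hP p hp)).le)
    (Finset.prod_le_one (fun p hp => ?_) fun p _ => one_sub_one_div_sq_le_one p)
  exact (one_sub_one_div_sq_pos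
    (Nat.prime_of_mem_primesBelow (Finset.mem_sdiff.1 hp).1)).le

/-- The odd primes up to `K`. -/
def oddPrimesUpTo (K : ℕ) : Finset ℕ := (Finset.range (K + 1)).filter fun q => q.Prime ∧ q ≠ 2

theorem mem_oddPrimesUpTo {K q : ℕ} : q ∈ oddPrimesUpTo K ↔ q ≤ K ∧ q.Prime ∧ q ≠ 2 := by
  simp [oddPrimesUpTo]

theorem primesBelow_succ_eq_insert (K : ℕ) (hK : 2 ≤ K) :
    (K + 1).primesBelow = insert 2 (oddPrimesUpTo K) := by
  ext q
  simp only [Nat.mem_primesBelow, Finset.mem_insert, mem_oddPrimesUpTo]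
  constructor
  · rintro ⟨h1, h2⟩
    by_cases h : q = 2
    · exact Or.inl h
    · exact Or.inr ⟨by omega, h2, h⟩
  · rintro (rfl | ⟨h1, h2, h3⟩)
    · exact ⟨by omega, Nat.prime_two⟩
    · exact ⟨by omega, h2⟩

theorem tendsto_prod_oddPrimesUpTo :
    Tendsto (fun K : ℕ => ∏ p ∈ oddPrimesUpTo K, (1 - 1 / (p : ℝ) ^ 2)) atTop
      (𝓝 (8 / Real.pi ^ 2)) := by
  have h := ((tendsto_add_atTop_iff_nat 1).2
    tendsto_prod_primesBelow_one_sub_inv_sq).const_mul (4 / 3 : ℝ)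
  have e : (4 / 3 : ℝ) * (6 / Real.pi ^ 2) = 8 / Real.pi ^ 2 := by ring
  rw [e] at h
  refine h.congr' ?_
  filter_upwards [eventually_ge_atTop 2] with K hK
  rw [primesBelow_succ_eq_insert K hK, Finset.prod_insert (by simp [mem_oddPrimesUpTo])]
  push_cast
  ring

theorem le_prod_odd_primes_one_sub_inv_sq (P : Finset ℕ) (hP : ∀ p ∈ P, p.Prime ∧ p ≠ 2) :
    8 / Real.pi ^ 2 ≤ ∏ p ∈ P, (1 - 1 / (p : ℝ) ^ 2) := by
  have h := le_prod_primes_one_sub_inv_sq (insert 2 P) (by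
    intro p hp
    rcases Finset.mem_insert.1 hp with rfl | hp
    · exact Nat.prime_two
    · exact (hP p hp).1)
  rw [Finset.prod_insert (fun h => (hP 2 h).2 rfl)] at h
  have e : (8 : ℝ) / Real.pi ^ 2 = 4 / 3 * (6 / Real.pi ^ 2) := by ring
  rw [e]
  push_cast at h
  linarith

/-! ### Counting in finite products of groups -/

theorem card_le_of_subset_six_union {α : Type*} [DecidableEq α] {U A B C D E F : Finset α}
    (h : U ⊆ A ∪ B ∪ (C ∪ D) ∪ (E ∪ F)) :
    U.card ≤ A.card + B.card + (C.card + D.card) + (E.card + F.card) := by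
  have h4 := Finset.card_le_card h
  have e1 := Finset.card_union_le (A ∪ B ∪ (C ∪ D)) (E ∪ F)
  have e2 := Finset.card_union_le (A ∪ B) (C ∪ D)
  have e3 := Finset.card_union_le A B
  have e4 := Finset.card_union_le C D
  have e5 := Finset.card_union_le E F
  omega

section FiniteProduct

set_option linter.unusedSectionVars false

variable {ι : Type*} [Fintype ι] [DecidableEq ι] {H : ι → Type*} [∀ i, AddCommGroup (H i)]
  [∀ i, Fintype (H i)] [∀ i, DecidableEq (H i)]

/-- Every sum of an element of `S` and an element of `T` vanishes in some coordinate. -/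
def SumsVanishSomewhere (S T : Finset (∀ i, H i)) : Prop :=
  ∀ g ∈ S, ∀ t ∈ T, ∃ i, g i + t i = 0

/-- The elements of `T` all have the same `i`-th coordinate. -/
def ConstantAt (T : Finset (∀ i, H i)) (i : ι) : Prop :=
  ∃ c, ∀ t ∈ T, t i = c

/-- Once the coordinates in F are frozen, S lies in a full box minus the box of points that avoid -t
in every free coordinate. -/
theorem card_fiber_diff (F : Finset ι) (c t : ∀ i, H i) (S : Finset (∀ i, H i))
    (hS : ∀ g ∈ S, (∀ i ∈ F, g i = c i) ∧ ∃ i ∉ F, g i + t i = 0) :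
    (S.card : ℝ) ≤ (1 - ∏ i ∈ Fᶜ, (1 - 1 / (Fintype.card (H i) : ℝ))) *
      ∏ i ∈ Fᶜ, (Fintype.card (H i) : ℝ) := by
  classical
  let B₁ := Fintype.piFinset fun i => if i ∈ F then {c i} else (Finset.univ : Finset (H i))
  let B₂ := Fintype.piFinset fun i =>
    if i ∈ F then {c i} else (Finset.univ : Finset (H i)).erase (-t i)
  have h12 : B₂ ⊆ B₁ := by
    apply Fintype.piFinset_subset
    intro i
    split_ifs
    · rfl
    · exact Finset.erase_subset _ _
  have hsub : S ⊆ B₁ \ B₂ := by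
    intro g hg
    obtain ⟨h1, i, hi, h2⟩ := hS g hg
    rw [Finset.mem_sdiff, Fintype.mem_piFinset, Fintype.mem_piFinset]
    constructor
    · intro j
      split_ifs with hj
      · simpa using h1 j hj
      · simp
    · intro h
      have := h i
      rw [if_neg hi, Finset.mem_erase] at this
      exact this.1 (eq_neg_of_add_eq_zero_left h2)
  have hcard := Finset.card_le_card hsub
  have hc1 : (B₁.card : ℝ) = ∏ i ∈ Fᶜ, (Fintype.card (H i) : ℝ) := by
    rw [Fintype.card_piFinset, ← Finset.prod_mul_prod_compl F, Finset.prod_eq_one, one_mul]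
    · push_cast
      refine Finset.prod_congr rfl fun i hi => ?_
      rw [if_neg (Finset.mem_compl.1 hi), Finset.card_univ]
    · intro i hi
      rw [if_pos hi, Finset.card_singleton]
  have hc2 : (B₂.card : ℝ) = (∏ i ∈ Fᶜ, (1 - 1 / (Fintype.card (H i) : ℝ))) *
      ∏ i ∈ Fᶜ, (Fintype.card (H i) : ℝ) := by
    rw [Fintype.card_piFinset, ← Finset.prod_mul_prod_compl F, Finset.prod_eq_one, one_mul,
      ← Finset.prod_mul_distrib]
    · push_cast
      refine Finset.prod_congr rfl fun i hi => ?_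
      have hpos : 0 < Fintype.card (H i) := Fintype.card_pos
      rw [if_neg (Finset.mem_compl.1 hi), Finset.card_erase_of_mem (Finset.mem_univ _),
        Finset.card_univ, Nat.cast_sub hpos]
      have : (Fintype.card (H i) : ℝ) ≠ 0 := by positivity
      field_simp
      simp
    · intro i hi
      rw [if_pos hi, Finset.card_singleton]
  rw [Finset.card_sdiff_of_subset h12] at hcard
  have h3 : (S.card : ℝ) ≤ (B₁.card : ℝ) - B₂.card := by
    rw [← Nat.cast_sub (Finset.card_le_card h12)]
    exact_mod_cast hcard
  rw [hc1, hc2] at h3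
  linarith

theorem card_eq_of_forall_mem_iff (F : Finset ι) (c : ∀ i, H i) (R : Finset (∀ i, H i))
    (hR : ∀ g, g ∈ R ↔ ∀ i ∈ F, g i = c i) :
    (R.card : ℝ) = ∏ i ∈ Fᶜ, (Fintype.card (H i) : ℝ) := by
  classical
  have : R = Fintype.piFinset fun i =>
      if i ∈ F then {c i} else (Finset.univ : Finset (H i)) := by
    ext g
    rw [hR, Fintype.mem_piFinset]
    refine forall_congr' fun i => ?_
    split_ifs with h <;> simp [h]
  rw [this, Fintype.card_piFinset, ← Finset.prod_mul_prod_compl F, Finset.prod_eq_one, one_mul]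
  · push_cast
    refine Finset.prod_congr rfl fun i hi => ?_
    rw [if_neg (Finset.mem_compl.1 hi), Finset.card_univ]
  · intro i hi
    rw [if_pos hi, Finset.card_singleton]

theorem card_le_div_of_forall_eq (F : Finset ι) (c : ∀ i, H i) (S : Finset (∀ i, H i))
    (hS : ∀ g ∈ S, ∀ i ∈ F, g i = c i) :
    (S.card : ℝ) ≤ (Fintype.card (∀ i, H i) : ℝ) / ∏ i ∈ F, (Fintype.card (H i) : ℝ) := by
  classical
  have h1 : S ⊆ Finset.univ.filter fun g => ∀ i ∈ F, g i = c i := fun g hg => by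
    simpa using hS g hg
  have h2 := card_eq_of_forall_mem_iff F c (Finset.univ.filter fun g => ∀ i ∈ F, g i = c i)
    (by simp)
  have h3 : (0 : ℝ) < ∏ i ∈ F, (Fintype.card (H i) : ℝ) :=
    Finset.prod_pos fun i _ => by exact_mod_cast Fintype.card_pos
  rw [Fintype.card_pi, Nat.cast_prod, ← Finset.prod_mul_prod_compl F, mul_comm,
    mul_div_cancel_right₀ _ h3.ne', ← h2]
  exact_mod_cast Finset.card_le_card h1

/-- The count is made fibre by fibre over the coordinates in F. The partner t may depend on the
fibre: this freedom lets the factors at F be dropped from the product. -/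
theorem card_le_of_vanish_outside (F : Finset ι) (S R : Finset (∀ i, H i)) (hSR : S ⊆ R)
    (hinv : ∀ g ∈ R, ∀ g', (∀ i ∈ F, g' i = g i) → g' ∈ R)
    (ht : ∀ g ∈ R, ∃ t : ∀ i, H i, ∀ g' ∈ S, (∀ i ∈ F, g' i = g i) → ∃ i ∉ F, g' i + t i = 0) :
    (S.card : ℝ) ≤
      (1 - ∏ i ∈ Fᶜ, (1 - 1 / (Fintype.card (H i) : ℝ))) * R.card := by
  classical
  let φ : (∀ i, H i) → ∀ i : F, H i := fun g i => g i
  have hφ : ∀ g g', φ g' = φ g ↔ ∀ i ∈ F, g' i = g i := by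
    intro g g'
    constructor
    · intro h i hi
      exact congrFun h ⟨i, hi⟩
    · intro h
      funext i
      exact h i i.2
  rw [Finset.card_eq_sum_card_fiberwise (f := φ) (s := S) (t := R.image φ)
      (fun g hg => Finset.mem_image_of_mem _ (hSR hg)),
    Finset.card_eq_sum_card_fiberwise (f := φ) (s := R) (t := R.image φ)
      (fun g hg => Finset.mem_image_of_mem _ hg)]
  push_cast
  rw [Finset.mul_sum]
  refine Finset.sum_le_sum fun b hb => ?_
  obtain ⟨g, hg, rfl⟩ := Finset.mem_image.1 hb
  obtain ⟨t, ht⟩ := ht g hg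
  rw [card_eq_of_forall_mem_iff F g (R.filter fun a => φ a = φ g)]
  · refine card_fiber_diff F g t _ fun g' hg' => ?_
    rw [Finset.mem_filter, hφ] at hg'
    exact ⟨hg'.2, ht g' hg'.1 hg'.2⟩
  · intro g'
    rw [Finset.mem_filter, hφ]
    exact ⟨fun h => h.2, fun h => ⟨hinv g hg g' h, h⟩⟩

/-- The proportion of elements vanishing in some coordinate outside `F`. -/
noncomputable def vanishProportion (H : ι → Type*) [∀ i, Fintype (H i)] (F : Finset ι) : ℝ :=
  1 - ∏ i ∈ Fᶜ, (1 - 1 / (Fintype.card (H i) : ℝ))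

theorem exists_ne_of_not_constantAt {T : Finset (∀ i, H i)} {p : ι} (h : ¬ ConstantAt T p)
    (c : H p) : ∃ t ∈ T, t p ≠ c := by
  by_contra! hc
  exact h ⟨c, hc⟩

theorem ConstantAt.mono {S T : Finset (∀ i, H i)} {p : ι} (h : ConstantAt T p) (hST : S ⊆ T) :
    ConstantAt S p := by
  obtain ⟨c, hc⟩ := h
  exact ⟨c, fun t ht => hc t (hST ht)⟩

theorem nonempty_of_not_constantAt {T : Finset (∀ i, H i)} {p : ι} (h : ¬ ConstantAt T p) :
    T.Nonempty := by
  obtain ⟨t, ht, -⟩ := exists_ne_of_not_constantAt h 0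
  exact ⟨t, ht⟩

theorem vanishProportion_nonneg (F : Finset ι) : 0 ≤ vanishProportion H F := by
  rw [vanishProportion, sub_nonneg]
  refine Finset.prod_le_one (fun i _ => ?_) (fun i _ => ?_)
  · have : (1 : ℝ) ≤ Fintype.card (H i) := by exact_mod_cast (Fintype.card_pos : 0 < _)
    rw [sub_nonneg, div_le_one (by linarith)]
    exact this
  · have : (0 : ℝ) ≤ 1 / Fintype.card (H i) := by positivity
    linarith

theorem SumsVanishSomewhere.card_le_of_nonempty {S T : Finset (∀ i, H i)}
    (h : SumsVanishSomewhere S T) (hT : T.Nonempty) :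
    (S.card : ℝ) ≤ vanishProportion H ∅ * Fintype.card (∀ i, H i) := by
  obtain ⟨t, ht⟩ := hT
  have := card_le_of_vanish_outside ∅ S Finset.univ (Finset.subset_univ _)
    (fun _ _ _ _ => Finset.mem_univ _)
    (fun g _ => ⟨t, fun g' hg' _ => by simpa using h g' hg' t ht⟩)
  rwa [Finset.card_univ] at this

/-- As T takes two values at p, each value of g p admits a partner that does not cancel it there, so
the vanishing must take place at another coordinate. -/
theorem SumsVanishSomewhere.card_le_of_not_constantAt {S T : Finset (∀ i, H i)}
    (h : SumsVanishSomewhere S T) {p : ι} (hT : ¬ ConstantAt T p) :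
    (S.card : ℝ) ≤ vanishProportion H {p} * Fintype.card (∀ i, H i) := by
  have := card_le_of_vanish_outside {p} S Finset.univ (Finset.subset_univ _)
    (fun _ _ _ _ => Finset.mem_univ _) (fun g _ => by
      obtain ⟨t, ht, htp⟩ := exists_ne_of_not_constantAt hT (-g p)
      refine ⟨t, fun g' hg' hgg' => ?_⟩
      obtain ⟨i, hi⟩ := h g' hg' t ht
      refine ⟨i, ?_, hi⟩
      rw [Finset.mem_singleton]
      rintro rfl
      rw [hgg' i (Finset.mem_singleton_self i)] at hi
      exact htp (eq_neg_of_add_eq_zero_right hi))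
  rwa [Finset.card_univ] at this

/-- Two savings multiply: S lies in a single slice at p, and within that slice one fixed partner
never cancels at p. -/
theorem SumsVanishSomewhere.card_le_of_forall_eq {S T : Finset (∀ i, H i)}
    (h : SumsVanishSomewhere S T) {p : ι} {c : H p} (hS : ∀ g ∈ S, g p = c)
    (hT : ∃ t ∈ T, c + t p ≠ 0) :
    (S.card : ℝ) ≤ vanishProportion H {p} *
      (Fintype.card (∀ i, H i) / Fintype.card (H p)) := by
  obtain ⟨t, ht, htp⟩ := hT
  have h1 := card_le_of_vanish_outside {p} S (Finset.univ.filter fun g => g p = c)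
    (fun g hg => by simpa using hS g hg)
    (fun g hg g' hgg' => by
      simp only [Finset.mem_filter, Finset.mem_univ, true_and] at hg ⊢
      rw [hgg' p (Finset.mem_singleton_self p), hg])
    (fun g _ => by
      refine ⟨t, fun g' hg' hgg' => ?_⟩
      obtain ⟨i, hi⟩ := h g' hg' t ht
      refine ⟨i, ?_, hi⟩
      rw [Finset.mem_singleton]
      rintro rfl
      rw [hS g' hg'] at hi
      exact htp hi)
  refine h1.trans (mul_le_mul_of_nonneg_left ?_ (vanishProportion_nonneg _))
  have h2 := card_le_div_of_forall_eq {p} (Function.update (0 : ∀ i, H i) p c)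
    (Finset.univ.filter fun g => g p = c) (by
      intro g hg i hi
      rw [Finset.mem_singleton] at hi
      subst hi
      simpa using hg)
  rwa [Finset.prod_singleton] at h2

theorem card_filter_two_coordinates {a b : ι} (hab : a ≠ b) (x : H a) (y : H b) :
    ((Finset.univ.filter fun g : ∀ i, H i => g a = x ∧ g b = y).card : ℝ) ≤
      Fintype.card (∀ i, H i) / (Fintype.card (H a) * Fintype.card (H b)) := by
  have h2 := card_le_div_of_forall_eq {a, b}
    (Function.update (Function.update (0 : ∀ i, H i) a x) b y)
    (Finset.univ.filter fun g => g a = x ∧ g b = y) (by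
      intro g hg i hi
      simp only [Finset.mem_filter, Finset.mem_univ, true_and] at hg
      rw [Finset.mem_insert, Finset.mem_singleton] at hi
      by_cases hib : i = b
      · subst hib
        simpa using hg.2
      · obtain rfl : i = a := hi.resolve_right hib
        simpa [Function.update_of_ne hib] using hg.1)
  rwa [Finset.prod_pair hab] at h2

/-- Either some partner avoids cancelling g at all of a, b, c, and the vanishing is elsewhere, or
every partner cancels g at one of them. In the second case two of the three coordinates of g are
determined: if t cancels g at a, then a partner differing from t at a must cancel it at b or c. This
leaves six prescribed pairs, two for each pair of coordinates. -/
theorem SumsVanishSomewhere.card_le_of_three {S T : Finset (∀ i, H i)}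
    (h : SumsVanishSomewhere S T) {a b c : ι} (hab : a ≠ b) (hac : a ≠ c) (hbc : b ≠ c)
    (hTa : ¬ ConstantAt T a) (hTb : ¬ ConstantAt T b) (hTc : ¬ ConstantAt T c) :
    (S.card : ℝ) ≤ (2 * (1 / ((Fintype.card (H a) : ℝ) * Fintype.card (H b)) +
      1 / ((Fintype.card (H a) : ℝ) * Fintype.card (H c)) +
      1 / ((Fintype.card (H b) : ℝ) * Fintype.card (H c))) + vanishProportion H {a, b, c}) *
      Fintype.card (∀ i, H i) := by
  classical
  obtain ⟨t, ht⟩ := nonempty_of_not_constantAt hTa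
  obtain ⟨ta, hta, hta'⟩ := exists_ne_of_not_constantAt hTa (t a)
  obtain ⟨tb, htb, htb'⟩ := exists_ne_of_not_constantAt hTb (t b)
  obtain ⟨tc, htc, htc'⟩ := exists_ne_of_not_constantAt hTc (t c)
  let F : Finset ι := {a, b, c}
  -- U is the exceptional set where no partner survives on F; membership depends only on the
  -- coordinates in F.
  let U : Finset (∀ i, H i) := Finset.univ.filter fun g => ∀ s ∈ T, ∃ i ∈ F, g i + s i = 0
  have h1 : ((S \ U).card : ℝ) ≤ vanishProportion H F * Fintype.card (∀ i, H i) := by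
    refine (card_le_of_vanish_outside F (S \ U) Uᶜ
      (fun g hg => by simpa using (Finset.mem_sdiff.1 hg).2) ?_ ?_).trans ?_
    · intro g hg g' hgg'
      simp only [U, Finset.mem_compl, Finset.mem_filter, Finset.mem_univ, true_and,
        not_forall] at hg ⊢
      obtain ⟨s, hs, hg⟩ := hg
      refine ⟨s, hs, fun hh => hg ?_⟩
      obtain ⟨i, hi, hh⟩ := hh
      exact ⟨i, hi, by rw [← hgg' i hi]; exact hh⟩
    · intro g hg
      simp only [U, Finset.mem_compl, Finset.mem_filter, Finset.mem_univ, true_and,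
        not_forall] at hg
      obtain ⟨s, hs, hg⟩ := hg
      refine ⟨s, fun g' hg' hgg' => ?_⟩
      obtain ⟨i, hi⟩ := h g' (Finset.mem_sdiff.1 hg').1 s hs
      exact ⟨i, fun hiF => hg ⟨i, hiF, by rw [← hgg' i hiF]; exact hi⟩, hi⟩
    · refine mul_le_mul_of_nonneg_left ?_ (vanishProportion_nonneg _)
      exact_mod_cast Finset.card_le_univ _
  let E : ∀ i j : ι, H i → H j → Finset (∀ i, H i) := fun i j x y =>
    Finset.univ.filter fun g => g i = x ∧ g j = y
  have h2 : U ⊆ E a b (-t a) (-ta b) ∪ E a c (-t a) (-ta c) ∪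
      (E b a (-t b) (-tb a) ∪ E b c (-t b) (-tb c)) ∪
      (E c a (-t c) (-tc a) ∪ E c b (-t c) (-tc b)) := by
    intro g hg
    simp only [U, F, Finset.mem_filter, Finset.mem_univ, true_and, Finset.mem_insert,
      Finset.mem_singleton, exists_eq_or_imp, exists_eq_left] at hg
    simp only [E, Finset.mem_union, Finset.mem_filter, Finset.mem_univ, true_and,
      eq_neg_iff_add_eq_zero]
    have ha : g a + t a = 0 → g a + ta a ≠ 0 := fun h1 h2 =>
      hta' (add_left_cancel (h2.trans h1.symm))
    have hb : g b + t b = 0 → g b + tb b ≠ 0 := fun h1 h2 =>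
      htb' (add_left_cancel (h2.trans h1.symm))
    have hc : g c + t c = 0 → g c + tc c ≠ 0 := fun h1 h2 =>
      htc' (add_left_cancel (h2.trans h1.symm))
    rcases hg t ht with h | h | h
    · rcases hg ta hta with k | k | k
      · exact absurd k (ha h)
      · exact Or.inl (Or.inl (Or.inl ⟨h, k⟩))
      · exact Or.inl (Or.inl (Or.inr ⟨h, k⟩))
    · rcases hg tb htb with k | k | k
      · exact Or.inl (Or.inr (Or.inl ⟨h, k⟩))
      · exact absurd k (hb h)
      · exact Or.inl (Or.inr (Or.inr ⟨h, k⟩))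
    · rcases hg tc htc with k | k | k
      · exact Or.inr (Or.inl ⟨h, k⟩)
      · exact Or.inr (Or.inr ⟨h, k⟩)
      · exact absurd k (hc h)
  have h3 : (U.card : ℝ) ≤ (E a b (-t a) (-ta b)).card + (E a c (-t a) (-ta c)).card +
      ((E b a (-t b) (-tb a)).card + (E b c (-t b) (-tb c)).card) +
      ((E c a (-t c) (-tc a)).card + (E c b (-t c) (-tc b)).card) := by
    exact_mod_cast card_le_of_subset_six_union h2
  have k1 := card_filter_two_coordinates hab (-t a) (-ta b)
  have k2 := card_filter_two_coordinates hac (-t a) (-ta c)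
  have k3 := card_filter_two_coordinates hab.symm (-t b) (-tb a)
  have k4 := card_filter_two_coordinates hbc (-t b) (-tb c)
  have k5 := card_filter_two_coordinates hac.symm (-t c) (-tc a)
  have k6 := card_filter_two_coordinates hbc.symm (-t c) (-tc b)
  have h5 : (S.card : ℝ) ≤ U.card + (S \ U).card := by
    have := Finset.card_le_card_sdiff_add_card (s := S) (t := U)
    rw [add_comm] at this
    exact_mod_cast this
  rw [mul_comm (Fintype.card (H b) : ℝ) (Fintype.card (H a))] at k3
  rw [mul_comm (Fintype.card (H c) : ℝ)] at k5 k6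
  have e : ∀ x y : ℝ, x / y = 1 / y * x := fun x y => by ring
  rw [e] at k1 k2 k3 k4 k5 k6
  simp only [E] at h3
  linarith

end FiniteProduct

/-! ### Residues modulo squares of odd primes -/

/-- The density `8 / π²` of the squarefree numbers among the odd numbers. -/
noncomputable def oddSquarefreeDensity : ℝ := 8 / Real.pi ^ 2

theorem oddSquarefreeDensity_gt : (0.81056 : ℝ) < oddSquarefreeDensity := by
  unfold oddSquarefreeDensity
  rw [lt_div_iff₀ (by positivity)]
  nlinarith [Real.pi_lt_d4, Real.pi_gt_d4]

theorem oddSquarefreeDensity_lt : oddSquarefreeDensity < (0.81062 : ℝ) := by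
  unfold oddSquarefreeDensity
  rw [div_lt_iff₀ (by positivity)]
  nlinarith [Real.pi_lt_d4, Real.pi_gt_d4]

abbrev OddPrime (K : ℕ) := {q : ℕ // q ∈ oddPrimesUpTo K}

theorem OddPrime.prime {K : ℕ} (q : OddPrime K) : q.1.Prime := (mem_oddPrimesUpTo.1 q.2).2.1

theorem OddPrime.ne_two {K : ℕ} (q : OddPrime K) : q.1 ≠ 2 := (mem_oddPrimesUpTo.1 q.2).2.2

theorem OddPrime.le {K : ℕ} (q : OddPrime K) : q.1 ≤ K := (mem_oddPrimesUpTo.1 q.2).1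

instance {K : ℕ} (q : OddPrime K) : NeZero (q.1 ^ 2) := ⟨pow_ne_zero _ q.prime.ne_zero⟩

/-- Families of residues modulo the squares of the odd primes up to `K`. -/
abbrev OddResidues (K : ℕ) := ∀ q : OddPrime K, ZMod (q.1 ^ 2)

/-- The number of residue families, i.e. the product of the squares of the odd primes up to `K`. -/
def oddModulus (K : ℕ) : ℕ := Fintype.card (OddResidues K)

def OddPrime.mk' (K p : ℕ) (hp : p.Prime) (h2 : p ≠ 2) (hK : p ≤ K) : OddPrime K :=
  ⟨p, mem_oddPrimesUpTo.2 ⟨hK, hp, h2⟩⟩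

abbrev oddPrimeSquare (K : ℕ) (q : OddPrime K) : Type := ZMod (q.1 ^ 2)

theorem card_oddPrimeSquare {K : ℕ} (q : OddPrime K) :
    (Fintype.card (oddPrimeSquare K q) : ℝ) = (q.1 : ℝ) ^ 2 := by
  rw [ZMod.card]
  push_cast
  rfl

/-- Dividing the full product, which is at least 8/π², by the factors at F bounds the product over
the remaining primes from below, uniformly in K. -/
theorem vanishProportion_le {K : ℕ} (F : Finset (OddPrime K)) :
    vanishProportion (oddPrimeSquare K) F ≤
      1 - oddSquarefreeDensity / ∏ q ∈ F, (1 - 1 / (q.1 : ℝ) ^ 2) := by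
  have hpos : 0 < ∏ q ∈ F, (1 - 1 / (q.1 : ℝ) ^ 2) :=
    Finset.prod_pos fun q _ => one_sub_one_div_sq_pos q.prime
  have h := le_prod_odd_primes_one_sub_inv_sq (oddPrimesUpTo K)
    fun p hp => (mem_oddPrimesUpTo.1 hp).2
  rw [← Finset.prod_coe_sort, ← Finset.prod_mul_prod_compl F] at h
  unfold vanishProportion
  rw [sub_le_sub_iff_left, div_le_iff₀ hpos, mul_comm]
  simp_rw [card_oddPrimeSquare]
  exact h

theorem vanishProportion_empty_le (K : ℕ) :
    vanishProportion (oddPrimeSquare K) ∅ ≤ 1 - oddSquarefreeDensity := by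
  simpa using vanishProportion_le (∅ : Finset (OddPrime K))

theorem vanishProportion_singleton_le {K : ℕ} (p : OddPrime K) :
    vanishProportion (oddPrimeSquare K) {p} ≤
      1 - oddSquarefreeDensity * (1 + 1 / ((p.1 : ℝ) ^ 2 - 1)) := by
  have h := vanishProportion_le {p}
  have h2 : (2 : ℝ) ≤ p.1 := by exact_mod_cast p.prime.two_le
  have h3 : (0 : ℝ) < (p.1 : ℝ) ^ 2 - 1 := by nlinarith
  rw [Finset.prod_singleton] at h
  have e : oddSquarefreeDensity / (1 - 1 / (p.1 : ℝ) ^ 2) =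
      oddSquarefreeDensity * (1 + 1 / ((p.1 : ℝ) ^ 2 - 1)) := by
    rw [div_eq_mul_inv (oddSquarefreeDensity)]
    congr 1
    have h4 : (p.1 : ℝ) ^ 2 ≠ 0 := by positivity
    have h5 := h3.ne'
    rw [one_sub_div h4, inv_div]
    field_simp
    ring
  rwa [e] at h

/-- Residue data of a set whose sumset avoids squarefree numbers: `X j` collects the residues of
the elements congruent to `j` modulo `4`, and the residues in `C j` are those whose sums with all
elements of `X k`, `j + k ≠ 0`, are divisible by the square of an odd prime up to `K`. -/
structure IsResidueCore {K : ℕ} (X C : ZMod 4 → Finset (OddResidues K)) : Prop where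
  subset : ∀ j, C j ⊆ X j
  vanish : ∀ j k, j + k ≠ 0 → SumsVanishSomewhere (C j) (X k)

/-- The union of the sets `X k` with `j + k ≠ 0`. -/
def compatible {K : ℕ} (X : ZMod 4 → Finset (OddResidues K)) (j : ZMod 4) :
    Finset (OddResidues K) :=
  (Finset.univ.filter fun k => j + k ≠ 0).biUnion X

theorem mem_compatible {K : ℕ} {X : ZMod 4 → Finset (OddResidues K)} {j : ZMod 4}
    {g : OddResidues K} : g ∈ compatible X j ↔ ∃ k, j + k ≠ 0 ∧ g ∈ X k := by
  simp [compatible]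

theorem mem_compatible_of_mem {K : ℕ} {X : ZMod 4 → Finset (OddResidues K)} {j k : ZMod 4}
    {g : OddResidues K} (hjk : j + k ≠ 0) (hg : g ∈ X k) : g ∈ compatible X j :=
  mem_compatible.2 ⟨k, hjk, hg⟩

theorem sum_zmod_four (f : ZMod 4 → ℝ) : ∑ j, f j = f 0 + f 1 + f 2 + f 3 :=
  Fin.sum_univ_four f

theorem sum_le_add_three_mul (f : ZMod 4 → ℝ) (j : ZMod 4) {b : ℝ} (h : ∀ k, k ≠ j → f k ≤ b) :
    ∑ k, f k ≤ f j + 3 * b := by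
  rw [← Finset.add_sum_erase _ _ (Finset.mem_univ j)]
  gcongr
  refine (Finset.sum_le_card_nsmul _ _ b fun k hk => h k (Finset.ne_of_mem_erase hk)).trans ?_
  rw [Finset.card_erase_of_mem (Finset.mem_univ j), Finset.card_univ, ZMod.card]
  norm_num

/-- For j = 0 or 2 the only class excluded from the partners of j is j itself. Hence all other
classes lie in `compatible X j` and inherit its constancy. -/
theorem zmod_four_add_ne_zero : ∀ j k : ZMod 4, j + j = 0 → k ≠ j → j + k ≠ 0 ∧ k + j ≠ 0 := by
  decide

/-! ### Bounds for the core according to where its partners are constant -/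

section Core

variable {K : ℕ} {X C : ZMod 4 → Finset (OddResidues K)}

theorem IsResidueCore.vanish_compatible (h : IsResidueCore X C) (j : ZMod 4) :
    SumsVanishSomewhere (C j) (compatible X j) := by
  intro g hg t ht
  obtain ⟨k, hk, ht⟩ := mem_compatible.1 ht
  exact h.vanish j k hk g hg t ht

theorem card_le_div_of_constantAt {S : Finset (OddResidues K)} {q : OddPrime K}
    (h : ConstantAt S q) :
    (S.card : ℝ) ≤ oddModulus K / (q.1 : ℝ) ^ 2 := by
  obtain ⟨c, hc⟩ := h
  have h2 := card_le_div_of_forall_eq {q} (Function.update (0 : OddResidues K) q c) S (by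
    intro g hg i hi
    rw [Finset.mem_singleton] at hi
    subst hi
    simpa using hc g hg)
  rw [Finset.prod_singleton, card_oddPrimeSquare] at h2
  exact h2

theorem card_le_div_of_constantAt_of_forall_mem {S : Finset (OddResidues K)}
    (F : Finset (OddPrime K)) (h : ∀ q ∈ F, ConstantAt S q) :
    (S.card : ℝ) ≤ oddModulus K / ∏ q ∈ F, (q.1 : ℝ) ^ 2 := by
  choose! c hc using h
  have h2 := card_le_div_of_forall_eq F c S fun g hg i hi => hc i hi g hg
  simp_rw [card_oddPrimeSquare] at h2
  exact h2

theorem IsResidueCore.card_le_of_forall_eq (h : IsResidueCore X C) {j k : ZMod 4}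
    (hjk : j + k ≠ 0) {p : OddPrime K} {c : ZMod (p.1 ^ 2)} (hS : ∀ g ∈ C j, g p = c)
    (hT : ∃ t ∈ X k, c + t p ≠ 0) :
    ((C j).card : ℝ) ≤ (1 - oddSquarefreeDensity * (1 + 1 / ((p.1 : ℝ) ^ 2 - 1))) *
      (oddModulus K / (p.1 : ℝ) ^ 2) := by
  have h1 := (h.vanish j k hjk).card_le_of_forall_eq hS hT
  rw [card_oddPrimeSquare] at h1
  exact h1.trans (mul_le_mul_of_nonneg_right (vanishProportion_singleton_le p) (by positivity))

theorem IsResidueCore.card_le_of_not_constantAt (h : IsResidueCore X C) {j : ZMod 4}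
    {p : OddPrime K} (hT : ¬ ConstantAt (compatible X j) p) :
    ((C j).card : ℝ) ≤ (1 - oddSquarefreeDensity * (1 + 1 / ((p.1 : ℝ) ^ 2 - 1))) *
      oddModulus K :=
  ((h.vanish_compatible j).card_le_of_not_constantAt hT).trans
    (mul_le_mul_of_nonneg_right (vanishProportion_singleton_le p) (by positivity))

theorem IsResidueCore.card_le_of_nonempty (h : IsResidueCore X C) {j : ZMod 4}
    (hT : (compatible X j).Nonempty) :
    ((C j).card : ℝ) ≤ (1 - oddSquarefreeDensity) * oddModulus K :=
  ((h.vanish_compatible j).card_le_of_nonempty hT).trans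
    (mul_le_mul_of_nonneg_right (vanishProportion_empty_le K) (by positivity))

/-- The prime `3` as an odd prime up to `K`. -/
def OddPrime.three {K : ℕ} (hK : 7 ≤ K) : OddPrime K :=
  OddPrime.mk' K 3 (by norm_num) (by norm_num) (by omega)

/-- The prime `5` as an odd prime up to `K`. -/
def OddPrime.five (hK : 7 ≤ K) : OddPrime K :=
  OddPrime.mk' K 5 (by norm_num) (by norm_num) (by omega)

/-- The prime `7` as an odd prime up to `K`. -/
def OddPrime.seven (hK : 7 ≤ K) : OddPrime K :=
  OddPrime.mk' K 7 (by norm_num) (by norm_num) (by omega)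

variable (hK : 7 ≤ K)

@[simp] theorem OddPrime.three_val : (OddPrime.three hK).1 = 3 := rfl
@[simp] theorem OddPrime.five_val : (OddPrime.five hK).1 = 5 := rfl
@[simp] theorem OddPrime.seven_val : (OddPrime.seven hK).1 = 7 := rfl

theorem OddPrime.ne_of_val_ne {p q : OddPrime K} (h : p.1 ≠ q.1) : p ≠ q := fun e => h (e ▸ rfl)

theorem add_self_ne_zero_at_three {c : ZMod ((OddPrime.three hK).1 ^ 2)} (hc : c ≠ 0) :
    c + c ≠ 0 := by
  have key : ∀ c : ZMod 9, c ≠ 0 → c + c ≠ 0 := by decide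
  exact key c hc

/-- The constant is 2(1/225 + 1/441 + 1/1225) + 1 - Q/((8/9)(24/25)(48/49)) < 0.0455, with Q = 8/π².
What matters is that 4 · 0.0455 = 0.182 stays below 1 - Q > 0.189. -/
theorem IsResidueCore.card_le_of_three (h : IsResidueCore X C) {j : ZMod 4}
    (h3 : ¬ ConstantAt (compatible X j) (OddPrime.three hK))
    (h5 : ¬ ConstantAt (compatible X j) (OddPrime.five hK))
    (h7 : ¬ ConstantAt (compatible X j) (OddPrime.seven hK)) :
    ((C j).card : ℝ) ≤ 0.0455 * oddModulus K := by
  have n35 : OddPrime.three hK ≠ OddPrime.five hK := OddPrime.ne_of_val_ne (by simp)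
  have n37 : OddPrime.three hK ≠ OddPrime.seven hK := OddPrime.ne_of_val_ne (by simp)
  have n57 : OddPrime.five hK ≠ OddPrime.seven hK := OddPrime.ne_of_val_ne (by simp)
  have h1 := (h.vanish_compatible j).card_le_of_three n35 n37 n57 h3 h5 h7
  rw [card_oddPrimeSquare, card_oddPrimeSquare, card_oddPrimeSquare] at h1
  have h2 := vanishProportion_le {OddPrime.three hK, OddPrime.five hK, OddPrime.seven hK}
  rw [Finset.prod_insert (by simp [n35, n37]), Finset.prod_pair n57] at h2
  simp only [OddPrime.three_val, OddPrime.five_val, OddPrime.seven_val] at h1 h2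
  refine h1.trans (mul_le_mul_of_nonneg_right ?_ (by positivity))
  have := oddSquarefreeDensity_gt
  norm_num at h2 ⊢
  linarith

/-- An odd class is its own partner, so constancy of the partners confines C j itself: to 1/25 or
1/49 of the residues at 5 or 7. At 3 a nonzero constant does not cancel itself modulo 9, which
leaves only the constant 0. -/
theorem IsResidueCore.card_odd_le (h : IsResidueCore X C) {j : ZMod 4} (hj : j + j ≠ 0) :
    ((C j).card : ℝ) ≤ 0.0455 * oddModulus K ∨
      ∀ t ∈ compatible X j, t (OddPrime.three hK) = 0 := by
  have hsub : C j ⊆ compatible X j := fun g hg => mem_compatible_of_mem hj (h.subset j hg)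
  have hV : (0 : ℝ) ≤ oddModulus K := by positivity
  by_cases h3 : ConstantAt (compatible X j) (OddPrime.three hK)
  · obtain ⟨c, hc⟩ := h3
    by_cases hc0 : c = 0
    · subst hc0
      exact Or.inr hc
    · left
      rcases (C j).eq_empty_or_nonempty with he | ⟨g, hg⟩
      · rw [he, Finset.card_empty, Nat.cast_zero]
        positivity
      · have h1 := h.card_le_of_forall_eq hj (fun g hg => hc g (hsub hg))
          ⟨g, h.subset j hg, by
            rw [hc g (hsub hg)]
            exact add_self_ne_zero_at_three hK hc0⟩
        simp only [OddPrime.three_val] at h1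
        have := oddSquarefreeDensity_gt
        norm_num at h1
        nlinarith
  · left
    by_cases h5 : ConstantAt (compatible X j) (OddPrime.five hK)
    · have := card_le_div_of_constantAt (h5.mono hsub)
      simp only [OddPrime.five_val] at this
      norm_num at this ⊢
      linarith
    by_cases h7 : ConstantAt (compatible X j) (OddPrime.seven hK)
    · have := card_le_div_of_constantAt (h7.mono hsub)
      simp only [OddPrime.seven_val] at this
      norm_num at this ⊢
      linarith
    exact h.card_le_of_three hK h3 h5 h7

/-- Bertrand's postulate applied to (p - 1)/2. -/
theorem exists_prime_between_half {p : ℕ} (hp : p.Prime) (h : 11 ≤ p) :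
    ∃ r, r.Prime ∧ 7 ≤ r ∧ r < p ∧ p < 2 * r := by
  have hodd : p % 2 = 1 := hp.eq_two_or_odd.resolve_left (by omega)
  obtain ⟨r, hr, h1, h2⟩ := Nat.exists_prime_lt_and_le_two_mul ((p - 1) / 2) (by omega)
  refine ⟨r, hr, ?_, by omega, by omega⟩
  have : r ≠ 6 := by rintro rfl; norm_num at hr
  omega

theorem eq_five_or_seven_or_ge {p : ℕ} (hp : p.Prime) (h2 : p ≠ 2) (h3 : p ≠ 3) :
    p = 5 ∨ p = 7 ∨ 11 ≤ p := by
  by_contra! hc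
  have : p < 11 := hc.2.2
  interval_cases p <;> first | omega | (norm_num at hp)

/-- Let p be the least prime at which the partners of j are not constant. Then C j falls short of (1
- Q)V by at least QV/(p² - 1), with Q = 8/π². The other three classes are confined to one residue
class modulo q² for every odd prime q < p, and together they cost less than this saving. -/
theorem IsResidueCore.sum_card_le_of_gain (h : IsResidueCore X C) {j : ZMod 4} (hj : j + j = 0)
    (hne : (compatible X j).Nonempty) {s : ZMod ((OddPrime.three hK).1 ^ 2)}
    (hs : ∀ t ∈ compatible X j, t (OddPrime.three hK) = s)
    (hx : ∃ x ∈ X j, s + x (OddPrime.three hK) ≠ 0) :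
    ∑ k, ((C k).card : ℝ) ≤ (1 - oddSquarefreeDensity) * oddModulus K + 3 := by
  have hV : (0 : ℝ) ≤ oddModulus K := by positivity
  have hQ := oddSquarefreeDensity_gt
  have hsub : ∀ k, k ≠ j → C k ⊆ compatible X j := fun k hk g hg =>
    mem_compatible_of_mem (zmod_four_add_ne_zero j k hj hk).1 (h.subset k hg)
  -- If the partners are constant everywhere, there is no saving, but each other class has at most
  -- one element: this is the origin of the term 3.
  by_cases hall : ∀ q, ConstantAt (compatible X j) q
  · have h1 : ∀ k, k ≠ j → ((C k).card : ℝ) ≤ 1 := by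
      intro k hk
      have : (C k).card ≤ 1 := by
        rw [Finset.card_le_one]
        intro a ha b hb
        funext q
        obtain ⟨c, hc⟩ := hall q
        rw [hc a (hsub k hk ha), hc b (hsub k hk hb)]
      exact_mod_cast this
    have h2 := sum_le_add_three_mul (fun k => ((C k).card : ℝ)) j h1
    have h3 := h.card_le_of_nonempty hne
    linarith
  · push Not at hall
    obtain ⟨q₀, hq₀⟩ := hall
    classical
    obtain ⟨p, hp, hmin⟩ := Finset.exists_min_image
      (Finset.univ.filter fun q => ¬ ConstantAt (compatible X j) q) (fun q => q.1)
      ⟨q₀, by simpa using hq₀⟩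
    simp only [Finset.mem_filter, Finset.mem_univ, true_and] at hp hmin
    have hlt : ∀ q : OddPrime K, q.1 < p.1 → ConstantAt (compatible X j) q := by
      intro q hq
      by_contra hc
      exact absurd (hmin q hc) (by omega)
    have hp3 : p.1 ≠ 3 := by
      intro e
      obtain rfl : p = OddPrime.three hK := Subtype.ext e
      exact hp ⟨s, hs⟩
    have hj0 := h.card_le_of_not_constantAt hp
    suffices ∃ b, (∀ k, k ≠ j → ((C k).card : ℝ) ≤ b * oddModulus K) ∧
        3 * b ≤ oddSquarefreeDensity * (1 / ((p.1 : ℝ) ^ 2 - 1)) by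
      obtain ⟨b, hb, hb'⟩ := this
      have h2 := sum_le_add_three_mul (fun k => ((C k).card : ℝ)) j hb
      have h4 := mul_le_mul_of_nonneg_right hb' hV
      linarith
    rcases eq_five_or_seven_or_ge p.prime p.ne_two hp3 with h5 | h7 | h11
    -- For p = 5 confinement modulo 9 alone would cost 3/9. The partner in X j that does not cancel
    -- s supplies the additional factor 1 - 9Q/8.
    · refine ⟨(1 - oddSquarefreeDensity * (1 + 1 / ((3 : ℝ) ^ 2 - 1))) / 9, fun k hk => ?_, ?_⟩
      · have h1 := h.card_le_of_forall_eq (zmod_four_add_ne_zero j k hj hk).2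
          (fun g hg => hs g (hsub k hk hg)) hx
        simp only [OddPrime.three_val] at h1
        refine h1.trans (le_of_eq ?_)
        push_cast
        ring
      · rw [h5]
        norm_num
        linarith
    · refine ⟨1 / 225, fun k hk => ?_, ?_⟩
      · have h1 := card_le_div_of_constantAt_of_forall_mem
          {OddPrime.three hK, OddPrime.five hK} (S := C k) (by
            intro q hq
            refine (hlt q ?_).mono (hsub k hk)
            rw [Finset.mem_insert, Finset.mem_singleton] at hq
            rcases hq with rfl | rfl <;> simp [h7])
        rw [Finset.prod_pair (OddPrime.ne_of_val_ne (by simp))] at h1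
        simp only [OddPrime.three_val, OddPrime.five_val] at h1
        norm_num at h1 ⊢
        linarith
      · rw [h7]
        norm_num
        linarith
    -- The primes 3, 5 and r < p < 2r give the cost 3/(225 r²), which is of the same order as the
    -- saving Q/(p² - 1) > Q/(4r²) but smaller.
    · obtain ⟨r, hr, hr7, hrp, hpr⟩ := exists_prime_between_half p.prime h11
      let r' : OddPrime K := OddPrime.mk' K r hr (by omega) (hrp.le.trans p.le)
      have hr' : r'.1 = r := rfl
      have hrpos : (7 : ℝ) ≤ r := by exact_mod_cast hr7
      have hppos : (11 : ℝ) ≤ p.1 := by exact_mod_cast h11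
      have hpr' : (p.1 : ℝ) < 2 * r := by exact_mod_cast hpr
      refine ⟨1 / (225 * (r : ℝ) ^ 2), fun k hk => ?_, ?_⟩
      · have h1 := card_le_div_of_constantAt_of_forall_mem
          {OddPrime.three hK, OddPrime.five hK, r'} (S := C k) (by
            intro q hq
            refine (hlt q ?_).mono (hsub k hk)
            rw [Finset.mem_insert, Finset.mem_insert, Finset.mem_singleton] at hq
            rcases hq with rfl | rfl | rfl
            · simp; omega
            · simp; omega
            · exact hrp)
        have n35 : OddPrime.three hK ≠ OddPrime.five hK := OddPrime.ne_of_val_ne (by simp)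
        have n3r : OddPrime.three hK ≠ r' :=
          OddPrime.ne_of_val_ne (by rw [hr']; simp; omega)
        have n5r : OddPrime.five hK ≠ r' :=
          OddPrime.ne_of_val_ne (by rw [hr']; simp; omega)
        rw [Finset.prod_insert (by simp [n35, n3r]), Finset.prod_pair n5r, hr'] at h1
        simp only [OddPrime.three_val, OddPrime.five_val] at h1
        refine h1.trans (le_of_eq ?_)
        push_cast
        field_simp
        ring
      · have e1 : oddSquarefreeDensity * (1 / (4 * (r : ℝ) ^ 2)) ≤
            oddSquarefreeDensity * (1 / ((p.1 : ℝ) ^ 2 - 1)) := by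
          refine mul_le_mul_of_nonneg_left ?_ (by linarith)
          exact one_div_le_one_div_of_le (by nlinarith) (by nlinarith)
        refine le_trans ?_ e1
        have e2 : 3 * (1 / (225 * (r : ℝ) ^ 2)) = 4 / 75 * (1 / (4 * (r : ℝ) ^ 2)) := by
          field_simp
          norm_num
        rw [e2]
        exact mul_le_mul_of_nonneg_right (by linarith) (by positivity)

/-- C j has proportion at most 1/9. An odd element supplies every other class with a partner of
residue s modulo 9, and 2s ≠ 0, so each of those has proportion at most (1 - 9Q/8)/9 < 0.01, where Q
= 8/π². Without odd elements the two even classes could reach 2/9 > 1 - Q, which is the two-class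
type. -/
theorem IsResidueCore.sum_card_le_of_opposite (h : IsResidueCore X C) {j i : ZMod 4}
    (hj : j + j = 0) (hi : i + i ≠ 0) (hXi : (X i).Nonempty)
    {s : ZMod ((OddPrime.three hK).1 ^ 2)} (hs0 : s ≠ 0)
    (hs : ∀ t ∈ compatible X j, t (OddPrime.three hK) = s)
    (hx : ∀ x ∈ X j, s + x (OddPrime.three hK) = 0) :
    ∑ k, ((C k).card : ℝ) ≤ (1 - oddSquarefreeDensity) * oddModulus K := by
  have hV : (0 : ℝ) ≤ oddModulus K := by positivity
  have hQ := oddSquarefreeDensity_gt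
  have hQ2 := oddSquarefreeDensity_lt
  have hX : ∀ k, k ≠ j → ∀ g ∈ X k, g (OddPrime.three hK) = s := fun k hk g hg =>
    hs g (mem_compatible_of_mem (zmod_four_add_ne_zero j k hj hk).1 hg)
  have hij : i ≠ j := by rintro rfl; exact hi hj
  have h1 : ∀ k, k ≠ j → ((C k).card : ℝ) ≤ 0.01 * oddModulus K := by
    intro k hk
    rcases (C k).eq_empty_or_nonempty with he | ⟨g, hg⟩
    · rw [he, Finset.card_empty, Nat.cast_zero]
      positivity
    · have : ∃ l, k + l ≠ 0 ∧ ∃ t ∈ X l, s + t (OddPrime.three hK) ≠ 0 := by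
        by_cases hkk : k + k = 0
        · obtain ⟨t, ht⟩ := hXi
          have key : ∀ k i : ZMod 4, k + k = 0 → i + i ≠ 0 → k + i ≠ 0 := by decide
          refine ⟨i, key k i hkk hi, t, ht, ?_⟩
          rw [hX i hij t ht]
          exact add_self_ne_zero_at_three hK hs0
        · refine ⟨k, hkk, g, h.subset k hg, ?_⟩
          rw [hX k hk g (h.subset k hg)]
          exact add_self_ne_zero_at_three hK hs0
      obtain ⟨l, hkl, ht⟩ := this
      have h2 := h.card_le_of_forall_eq hkl (fun g hg => hX k hk g (h.subset k hg)) ht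
      simp only [OddPrime.three_val] at h2
      norm_num at h2 ⊢
      nlinarith
  have h2 := sum_le_add_three_mul (fun k => ((C k).card : ℝ)) j h1
  have h3 : ConstantAt (C j) (OddPrime.three hK) :=
    ⟨-s, fun g hg => eq_neg_of_add_eq_zero_right (hx g (h.subset j hg))⟩
  have h4 := card_le_div_of_constantAt h3
  simp only [OddPrime.three_val] at h4
  norm_num at h4 h2
  nlinarith

theorem IsResidueCore.card_le_of_not_constantAt_three (h : IsResidueCore X C) {j : ZMod 4}
    (hT : ¬ ConstantAt (compatible X j) (OddPrime.three hK)) :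
    ((C j).card : ℝ) ≤ 0.0882 * oddModulus K := by
  have h1 := h.card_le_of_not_constantAt hT
  refine h1.trans (mul_le_mul_of_nonneg_right ?_ (by positivity))
  have hQ := oddSquarefreeDensity_gt
  simp only [OddPrime.three_val]
  norm_num
  linarith

/-- Either X j is opposite to the common residue modulo q², and all four classes are at most V/25,
or some element of X j does not cancel it. Then the other classes are at most 0.2 · V/25, while C j
is at most 0.0882 V because its partners vary modulo 9. -/
theorem IsResidueCore.sum_card_le_of_constantAt (h : IsResidueCore X C) {j : ZMod 4}
    (hj : j + j = 0) (h3 : ¬ ConstantAt (compatible X j) (OddPrime.three hK)) {q : OddPrime K}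
    (hq5 : 5 ≤ q.1) (hq : ConstantAt (compatible X j) q) :
    ∑ k, ((C k).card : ℝ) ≤ (1 - oddSquarefreeDensity) * oddModulus K := by
  have hV : (0 : ℝ) ≤ oddModulus K := by positivity
  have hQ := oddSquarefreeDensity_gt
  have hQ2 := oddSquarefreeDensity_lt
  have hq' : (5 : ℝ) ≤ q.1 := by exact_mod_cast hq5
  have hdiv : (oddModulus K : ℝ) / (q.1 : ℝ) ^ 2 ≤
      0.04 * oddModulus K := by
    rw [div_le_iff₀ (by positivity)]
    nlinarith [mul_le_mul hq' hq' (by norm_num) (by positivity)]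
  obtain ⟨c, hc⟩ := hq
  have hX : ∀ k, k ≠ j → ∀ g ∈ X k, g q = c := fun k hk g hg =>
    hc g (mem_compatible_of_mem (zmod_four_add_ne_zero j k hj hk).1 hg)
  by_cases hx : ∀ x ∈ X j, c + x q = 0
  · have h1 : ∀ k, ((C k).card : ℝ) ≤ 0.04 * oddModulus K := by
      intro k
      refine (card_le_div_of_constantAt (q := q) ?_).trans hdiv
      by_cases hk : k = j
      · subst hk
        exact ⟨-c, fun g hg => eq_neg_of_add_eq_zero_right (hx g (h.subset k hg))⟩
      · exact ⟨c, fun g hg => hX k hk g (h.subset k hg)⟩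
    have h2 := sum_le_add_three_mul (fun k => ((C k).card : ℝ)) j fun k _ => h1 k
    have h3 := h1 j
    nlinarith
  · push Not at hx
    have h1 : ∀ k, k ≠ j → ((C k).card : ℝ) ≤ 0.008 * oddModulus K := by
      intro k hk
      have h2 := h.card_le_of_forall_eq (zmod_four_add_ne_zero j k hj hk).2
        (fun g hg => hX k hk g (h.subset k hg)) hx
      have h4 : 1 - oddSquarefreeDensity * (1 + 1 / ((q.1 : ℝ) ^ 2 - 1)) ≤ 0.2 := by
        have : 0 ≤ oddSquarefreeDensity * (1 / ((q.1 : ℝ) ^ 2 - 1)) :=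
          mul_nonneg (by linarith) (one_div_nonneg.2 (by nlinarith))
        linarith
      have h5 : (0 : ℝ) ≤ oddModulus K / (q.1 : ℝ) ^ 2 := by positivity
      nlinarith
    have h2 := sum_le_add_three_mul (fun k => ((C k).card : ℝ)) j h1
    have h5 := h.card_le_of_not_constantAt_three hK h3
    nlinarith

/-- The element x nonzero modulo 9 must lie in the opposite odd class i = -j. It is a partner of
both even classes, whose elements are 0 modulo 9, and makes them small; it also rules out the
exceptional case of `card_odd_le` for i. The total proportion is at most 1/9 + 0.0455 + 0.02. -/
theorem IsResidueCore.sum_card_le_of_forall_eq_zero (h : IsResidueCore X C) {j : ZMod 4}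
    (hj : j + j ≠ 0) (hT : ∀ t ∈ compatible X j, t (OddPrime.three hK) = 0)
    (h9 : ∃ k, ∃ x ∈ X k, x (OddPrime.three hK) ≠ 0) :
    ∑ k, ((C k).card : ℝ) ≤ (1 - oddSquarefreeDensity) * oddModulus K := by
  have hV : (0 : ℝ) ≤ oddModulus K := by positivity
  have hQ := oddSquarefreeDensity_gt
  have hQ2 := oddSquarefreeDensity_lt
  obtain ⟨i, x, hx, hx0⟩ := h9
  have hji : j + i = 0 := by
    by_contra hji
    exact hx0 (hT x (mem_compatible_of_mem hji hx))
  have hX : ∀ k, j + k ≠ 0 → ∀ g ∈ C k, g (OddPrime.three hK) = 0 := fun k hk g hg =>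
    hT g (mem_compatible_of_mem hk (h.subset k hg))
  have heven : ∀ k, k + k = 0 → ((C k).card : ℝ) ≤ 0.01 * oddModulus K := by
    intro k hk
    have key : ∀ j i k : ZMod 4, j + j ≠ 0 → j + i = 0 → k + k = 0 →
      j + k ≠ 0 ∧ k + i ≠ 0 := by decide
    obtain ⟨k1, k2⟩ := key j i k hj hji hk
    have h2 := h.card_le_of_forall_eq k2 (hX k k1) ⟨x, hx, by rwa [zero_add]⟩
    simp only [OddPrime.three_val] at h2
    norm_num at h2 ⊢
    nlinarith
  have hCj : ((C j).card : ℝ) ≤ oddModulus K / 9 := by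
    have h4 := card_le_div_of_constantAt (S := C j) ⟨0, hX j hj⟩
    simp only [OddPrime.three_val] at h4
    norm_num at h4
    exact h4
  have hii : i + i ≠ 0 := by
    have key : ∀ j i : ZMod 4, j + j ≠ 0 → j + i = 0 → i + i ≠ 0 := by decide
    exact key j i hj hji
  have hCi : ((C i).card : ℝ) ≤ 0.0455 * oddModulus K :=
    (h.card_odd_le hK hii).resolve_right fun hh => hx0 (hh x (mem_compatible_of_mem hii hx))
  have hc0 := heven 0 (by decide)
  have hc2 := heven 2 (by decide)
  have key : ∀ j i : ZMod 4, j + j ≠ 0 → j + i = 0 → (j = 1 ∧ i = 3) ∨ (j = 3 ∧ i = 1) := by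
    decide
  rw [sum_zmod_four]
  rcases key j i hj hji with ⟨rfl, rfl⟩ | ⟨rfl, rfl⟩ <;> nlinarith

/-- The density bound for the residues of a set whose sumset avoids squarefree numbers. -/
theorem IsResidueCore.sum_card_le (h : IsResidueCore X C)
    (h0 : (compatible X 0).Nonempty) (h2 : (compatible X 2).Nonempty)
    (h9 : ∃ k, ∃ x ∈ X k, x (OddPrime.three hK) ≠ 0)
    (htwo : X 1 = ∅ → X 3 = ∅ → ∀ s : ZMod ((OddPrime.three hK).1 ^ 2), s ≠ 0 →
      (∀ x ∈ X 2, x (OddPrime.three hK) = s) → ¬ ∀ x ∈ X 0, x (OddPrime.three hK) = -s) :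
    ∑ k, ((C k).card : ℝ) ≤ (1 - oddSquarefreeDensity) * oddModulus K + 3 := by
  have hV : (0 : ℝ) ≤ oddModulus K := by positivity
  have hQ := oddSquarefreeDensity_gt
  have hQ2 := oddSquarefreeDensity_lt
  by_contra hcon
  have hcon' : ¬ ∑ k, ((C k).card : ℝ) ≤
      (1 - oddSquarefreeDensity) * oddModulus K := fun hh => hcon (by linarith)
  have main : ∀ j : ZMod 4, j + j = 0 → (compatible X j).Nonempty →
      ¬ ConstantAt (compatible X j) (OddPrime.three hK) := by
    rintro j hj hne ⟨s, hs⟩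
    by_cases hx : ∃ x ∈ X j, s + x (OddPrime.three hK) ≠ 0
    · exact hcon (h.sum_card_le_of_gain hK hj hne hs hx)
    push Not at hx
    have hXk : ∀ k, k ≠ j → ∀ g ∈ X k, g (OddPrime.three hK) = s := fun k hk g hg =>
      hs g (mem_compatible_of_mem (zmod_four_add_ne_zero j k hj hk).1 hg)
    have hXj : ∀ g ∈ X j, g (OddPrime.three hK) = -s := fun g hg =>
      eq_neg_of_add_eq_zero_right (hx g hg)
    -- With s = 0 all residues would vanish modulo 9, against `h9`.
    have hs0 : s ≠ 0 := by
      rintro rfl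
      obtain ⟨k, x, hxk, hx0⟩ := h9
      by_cases hk : k = j
      · subst hk
        exact hx0 ((hXj x hxk).trans neg_zero)
      · exact hx0 (hXk k hk x hxk)
    -- Without odd classes this is the two-class configuration excluded by `htwo`, with s or -s
    -- according to whether j is 0 or 2.
    rcases (X 1).eq_empty_or_nonempty with h1 | h1
    · rcases (X 3).eq_empty_or_nonempty with h3 | h3
      · have key : ∀ j : ZMod 4, j + j = 0 → j = 0 ∨ j = 2 := by decide
        rcases key j hj with rfl | rfl
        · exact htwo h1 h3 s hs0 (hXk 2 (by decide)) hXj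
        · exact htwo h1 h3 (-s) (neg_ne_zero.2 hs0) hXj (by
            rw [neg_neg]
            exact hXk 0 (by decide))
      · exact hcon' (h.sum_card_le_of_opposite hK hj (by decide) h3 hs0 hs hx)
    · exact hcon' (h.sum_card_le_of_opposite hK hj (by decide) h1 hs0 hs hx)
  have n0 := main 0 (by decide) h0
  have n2 := main 2 (by decide) h2
  have hodd : ∀ j : ZMod 4, j + j ≠ 0 →
      ((C j).card : ℝ) ≤ 0.0455 * oddModulus K := fun j hj =>
    (h.card_odd_le hK hj).resolve_right fun hT =>
      hcon' (h.sum_card_le_of_forall_eq_zero hK hj hT h9)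
  have heven : ∀ j : ZMod 4, j + j = 0 → ¬ ConstantAt (compatible X j) (OddPrime.three hK) →
      ((C j).card : ℝ) ≤ 0.0455 * oddModulus K := fun j hj hn =>
    h.card_le_of_three hK hn
      (fun hc => hcon' (h.sum_card_le_of_constantAt hK hj hn (by simp) hc))
      (fun hc => hcon' (h.sum_card_le_of_constantAt hK hj hn (by simp) hc))
  have c0 := heven 0 (by decide) n0
  have c2 := heven 2 (by decide) n2
  have c1 := hodd 1 (by decide)
  have c3 := hodd 3 (by decide)
  -- All four classes are now below 0.0455 V, and 0.182 < 1 - 0.81062.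
  refine hcon' ?_
  rw [sum_zmod_four]
  nlinarith

end Core

/-! ### Sets whose sumset avoids squarefree numbers -/

theorem card_le_div_add_one_of_modEq {S : Finset ℕ} {N L : ℕ}
    (hN : ∀ n ∈ S, n ≤ N) (hS : ∀ n ∈ S, ∀ m ∈ S, n ≡ m [MOD L]) :
    (S.card : ℝ) ≤ N / L + 1 := by
  have h1 : S.card ≤ (Finset.range (N / L + 1)).card := by
    refine Finset.card_le_card_of_injOn (fun n => n / L) (fun n hn => ?_) fun n hn m hm h => ?_
    · simpa [Nat.lt_succ_iff] using Nat.div_le_div_right (hN n hn)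
    · have h2 : n % L = m % L := hS n hn m hm
      have h3 : n / L = m / L := h
      rw [← Nat.div_add_mod n L, ← Nat.div_add_mod m L, h2, h3]
  rw [Finset.card_range] at h1
  have h2 : ((N / L : ℕ) : ℝ) ≤ N / L := Nat.cast_div_le
  have h3 : (S.card : ℝ) ≤ ((N / L : ℕ) : ℝ) + 1 := by exact_mod_cast h1
  linarith

theorem sum_Ioc_inv_sq_le {K : ℕ} (hK : K ≠ 0) (M : ℕ) :
    ∑ i ∈ Finset.Ioc K M, ((i : ℝ) ^ 2)⁻¹ ≤ (K : ℝ)⁻¹ := by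
  rcases le_total K M with h | h
  · have h1 := sum_Ioc_inv_sq_le_sub (α := ℝ) hK h
    have h2 : (0 : ℝ) ≤ (M : ℝ)⁻¹ := by positivity
    linarith
  · rw [Finset.Ioc_eq_empty_of_le h]
    simp

theorem oddModulus_eq_prod (K : ℕ) : oddModulus K = ∏ q : OddPrime K, q.1 ^ 2 := by
  unfold oddModulus
  rw [Fintype.card_pi]
  exact Finset.prod_congr rfl fun q _ => ZMod.card _

theorem oddModulus_pos (K : ℕ) : 0 < oddModulus K := Fintype.card_pos

theorem OddPrime.coprime_sq {K : ℕ} {p q : OddPrime K} (h : p ≠ q) :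
    Nat.Coprime (p.1 ^ 2) (q.1 ^ 2) :=
  Nat.Coprime.pow _ _ ((Nat.coprime_primes p.prime q.prime).2 fun e => h (Subtype.ext e))

theorem coprime_four_oddModulus (K : ℕ) : Nat.Coprime 4 (oddModulus K) := by
  rw [oddModulus_eq_prod]
  refine Nat.Coprime.prod_right fun q _ => Nat.Coprime.pow_right _ ?_
  exact Nat.Coprime.pow_left 2 ((Nat.coprime_primes Nat.prime_two q.prime).2 q.ne_two.symm)

theorem coprime_four_mul_oddModulus_sq {K q : ℕ} (hq : q.Prime) (hK : K < q) (h2 : 2 < q) :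
    Nat.Coprime (4 * oddModulus K) (q ^ 2) := by
  refine Nat.Coprime.pow_right _ (Nat.Coprime.mul_left ?_ ?_)
  · exact Nat.Coprime.pow_left 2 ((Nat.coprime_primes Nat.prime_two hq).2 (by omega))
  · rw [oddModulus_eq_prod]
    refine Nat.Coprime.prod_left fun p _ => Nat.Coprime.pow_left _ ?_
    have := p.le
    exact (Nat.coprime_primes p.prime hq).2 (by omega)

/-- The residues of `n` modulo the squares of the odd primes up to `K`. -/
def oddResidue (K n : ℕ) : OddResidues K := fun _ => n

theorem modEq_oddModulus {K n m : ℕ} (h4 : (n : ZMod 4) = m)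
    (h : oddResidue K n = oddResidue K m) : n ≡ m [MOD 4 * oddModulus K] := by
  rw [← Nat.modEq_and_modEq_iff_modEq_mul (coprime_four_oddModulus K)]
  refine ⟨(ZMod.natCast_eq_natCast_iff _ _ _).1 h4, ?_⟩
  rw [Nat.modEq_iff_dvd, oddModulus_eq_prod]
  push_cast
  refine Finset.prod_dvd_of_coprime (fun p _ q _ hpq => ?_) fun q _ => ?_
  · have := OddPrime.coprime_sq hpq
    exact Nat.isCoprime_iff_coprime.2 this
  · have h2 : ((n : ℕ) : ZMod (q.1 ^ 2)) = m := congrFun h q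
    have := Nat.modEq_iff_dvd.1 ((ZMod.natCast_eq_natCast_iff _ _ _).1 h2)
    exact_mod_cast this

/-- The residues of the elements of `A` congruent to `j` modulo `4`. -/
def residueClasses (K : ℕ) (A : Finset ℕ) (j : ZMod 4) : Finset (OddResidues K) :=
  (A.filter fun n : ℕ => (n : ZMod 4) = j).image (oddResidue K)

open Classical in
/-- The residues in `residueClasses K A j` which sum to a multiple of an odd square with every
element of `A` outside the class `-j` modulo `4`. -/
noncomputable def residueCore (K : ℕ) (A : Finset ℕ) (j : ZMod 4) : Finset (OddResidues K) :=
  (residueClasses K A j).filter fun g =>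
    ∀ k, j + k ≠ 0 → ∀ s ∈ residueClasses K A k, ∃ q, g q + s q = 0

theorem mem_residueClasses {K : ℕ} {A : Finset ℕ} {j : ZMod 4} {g : OddResidues K} :
    g ∈ residueClasses K A j ↔ ∃ n ∈ A, (n : ZMod 4) = j ∧ oddResidue K n = g := by
  simp [residueClasses, and_assoc]

theorem mem_residueClasses_of_mem (K : ℕ) {A : Finset ℕ} {n : ℕ} (hn : n ∈ A) :
    oddResidue K n ∈ residueClasses K A n :=
  mem_residueClasses.2 ⟨n, hn, rfl, rfl⟩

theorem isResidueCore_residueCore (K : ℕ) (A : Finset ℕ) :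
    IsResidueCore (residueClasses K A) (residueCore K A) where
  subset _ := Finset.filter_subset _ _
  vanish j k hjk g hg s hs := by
    classical
    exact (Finset.mem_filter.1 hg).2 k hjk s hs

theorem exists_large_prime_sq_dvd {K n : ℕ} (h : ¬ Squarefree n) (h4 : (n : ZMod 4) ≠ 0)
    (hodd : ∀ q : OddPrime K, (n : ZMod (q.1 ^ 2)) ≠ 0) :
    ∃ q, q.Prime ∧ K < q ∧ 2 < q ∧ q ^ 2 ∣ n := by
  rw [Nat.squarefree_iff_prime_squarefree] at h
  push Not at h
  obtain ⟨q, hq, hqn⟩ := h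
  rw [← sq] at hqn
  have h2 : q ≠ 2 := by
    rintro rfl
    exact h4 ((ZMod.natCast_eq_zero_iff _ _).2 hqn)
  have hge := hq.two_le
  refine ⟨q, hq, ?_, by omega, hqn⟩
  by_contra hK
  exact hodd ⟨q, mem_oddPrimesUpTo.2 ⟨by omega, hq, h2⟩⟩
    ((ZMod.natCast_eq_zero_iff _ _).2 hqn)

/-- For each prime q > K, q² is coprime to 4V, so S meets one class modulo 4Vq². Since n + m ≤ 2N
only q ≤ √(2N) occur; the main terms sum to at most 1/K times the class size, and the rounding
errors to √(2N). -/
theorem card_le_of_large_prime_sq_dvd {K N m : ℕ} (hK : K ≠ 0) {S : Finset ℕ}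
    (hN : ∀ n ∈ S, n ≤ N) (hm : m ≤ N)
    (hS : ∀ n ∈ S, ∀ n' ∈ S, n ≡ n' [MOD 4 * oddModulus K])
    (hq : ∀ n ∈ S, ∃ q, q.Prime ∧ K < q ∧ 2 < q ∧ q ^ 2 ∣ n + m) (hpos : ∀ n ∈ S, 0 < n) :
    (S.card : ℝ) ≤ N / (4 * oddModulus K) * (K : ℝ)⁻¹ + Real.sqrt (2 * N) := by
  classical
  let M := Nat.sqrt (2 * N)
  let P := (Finset.Ioc K M).filter fun q => q.Prime ∧ 2 < q
  have hsub : S ⊆ P.biUnion fun q => S.filter fun n => q ^ 2 ∣ n + m := by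
    intro n hn
    obtain ⟨q, hq1, hq2, hq3, hq4⟩ := hq n hn
    rw [Finset.mem_biUnion]
    refine ⟨q, ?_, Finset.mem_filter.2 ⟨hn, hq4⟩⟩
    refine Finset.mem_filter.2 ⟨Finset.mem_Ioc.2 ⟨hq2, ?_⟩, hq1, hq3⟩
    rw [Nat.le_sqrt']
    have := Nat.le_of_dvd (by have := hpos n hn; omega) hq4
    have := hN n hn
    omega
  have hV : (0 : ℝ) < oddModulus K := by exact_mod_cast oddModulus_pos K
  have hpart : ∀ q ∈ P, ((S.filter fun n => q ^ 2 ∣ n + m).card : ℝ) ≤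
      N / (4 * oddModulus K) * ((q : ℝ) ^ 2)⁻¹ + 1 := by
    intro q hqP
    obtain ⟨hq1, hq2, hq3⟩ := Finset.mem_filter.1 hqP
    have hK' := (Finset.mem_Ioc.1 hq1).1
    have h1 := card_le_div_add_one_of_modEq (S := S.filter fun n => q ^ 2 ∣ n + m) (N := N)
      (L := 4 * oddModulus K * q ^ 2)
      (fun n hn => hN n (Finset.mem_filter.1 hn).1) (by
        intro n hn n' hn'
        rw [Finset.mem_filter] at hn hn'
        rw [← Nat.modEq_and_modEq_iff_modEq_mul (coprime_four_mul_oddModulus_sq hq2 hK' hq3)]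
        refine ⟨hS n hn.1 n' hn'.1, Nat.ModEq.add_right_cancel' m ?_⟩
        exact (Nat.modEq_zero_iff_dvd.2 hn.2).trans (Nat.modEq_zero_iff_dvd.2 hn'.2).symm)
    refine h1.trans (le_of_eq ?_)
    push_cast
    rw [← div_eq_mul_inv, div_div]
  calc (S.card : ℝ) ≤ ((P.biUnion fun q => S.filter fun n => q ^ 2 ∣ n + m).card : ℝ) := by
        exact_mod_cast Finset.card_le_card hsub
    _ ≤ ∑ q ∈ P, ((S.filter fun n => q ^ 2 ∣ n + m).card : ℝ) := by
        exact_mod_cast Finset.card_biUnion_le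
    _ ≤ ∑ q ∈ P, (N / (4 * oddModulus K) * ((q : ℝ) ^ 2)⁻¹ + 1) := Finset.sum_le_sum hpart
    _ ≤ ∑ q ∈ Finset.Ioc K M, (N / (4 * oddModulus K) * ((q : ℝ) ^ 2)⁻¹ + 1) :=
        Finset.sum_le_sum_of_subset_of_nonneg (Finset.filter_subset _ _)
          fun _ _ _ => by positivity
    _ = N / (4 * oddModulus K) * ∑ q ∈ Finset.Ioc K M, ((q : ℝ) ^ 2)⁻¹ + ((M - K : ℕ) : ℝ) := by
        rw [Finset.sum_add_distrib, Finset.mul_sum]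
        simp
    _ ≤ N / (4 * oddModulus K) * (K : ℝ)⁻¹ + Real.sqrt (2 * N) := by
        gcongr
        · exact sum_Ioc_inv_sq_le hK M
        · have h1 : ((M - K : ℕ) : ℝ) ≤ M := by exact_mod_cast Nat.sub_le _ _
          refine h1.trans (Real.le_sqrt_of_sq_le ?_)
          exact_mod_cast Nat.sqrt_le' (2 * N)

/-- Elements in core classes are counted class by class modulo 4V. A class outside the core has a
fixed m in A whose sum with the class is nonzero modulo 4 and modulo every q² dividing V, so only
squares of primes above K remain. -/
theorem card_le_sum_card_residueCore {K N : ℕ} (hK : K ≠ 0) {A : Finset ℕ}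
    (hA : ∀ n ∈ A, 1 ≤ n ∧ n ≤ N) (hsq : ∀ m ∈ A + A, ¬ Squarefree m) :
    (A.card : ℝ) ≤ (∑ j, ((residueCore K A j).card : ℝ)) * (N / (4 * oddModulus K) + 1) +
      (N * (K : ℝ)⁻¹ + 4 * oddModulus K * Real.sqrt (2 * N)) := by
  classical
  have hV : (0 : ℝ) < oddModulus K := by exact_mod_cast oddModulus_pos K
  let p : ℕ → Prop := fun n => oddResidue K n ∈ residueCore K A n
  rw [← Finset.card_filter_add_card_filter_not p, Nat.cast_add]
  refine add_le_add ?_ ?_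
  · let f : ℕ → Σ _ : ZMod 4, OddResidues K := fun n => ⟨n, oddResidue K n⟩
    have hmaps : Set.MapsTo f (A.filter p) (Finset.univ.sigma (residueCore K A)) := by
      intro n hn
      have := (Finset.mem_filter.1 hn).2
      simpa [f] using this
    rw [Finset.card_eq_sum_card_fiberwise hmaps]
    push_cast
    refine (Finset.sum_le_card_nsmul _ _ (N / (4 * oddModulus K) + 1 : ℝ) ?_).trans (le_of_eq ?_)
    · rintro b -
      have := card_le_div_add_one_of_modEq (S := (A.filter p).filter fun n => f n = b)
        (fun n hn => (hA n (Finset.mem_filter.1 (Finset.mem_filter.1 hn).1).1).2)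
        (fun n hn m hm => by
          have e := (Finset.mem_filter.1 hn).2.trans (Finset.mem_filter.1 hm).2.symm
          simp only [f, Sigma.mk.injEq, heq_eq_eq] at e
          exact modEq_oddModulus e.1 e.2)
      exact_mod_cast this
    · rw [Finset.card_sigma, nsmul_eq_mul]
      push_cast
      rfl
  · let f : ℕ → ZMod 4 × OddResidues K := fun n => (n, oddResidue K n)
    rw [Finset.card_eq_sum_card_fiberwise (f := f) (t := Finset.univ)
      (fun _ _ => Finset.mem_coe.2 (Finset.mem_univ _))]
    push_cast
    refine (Finset.sum_le_card_nsmul _ _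
      (N / (4 * oddModulus K) * (K : ℝ)⁻¹ + Real.sqrt (2 * N) : ℝ) ?_).trans (le_of_eq ?_)
    · rintro b -
      rcases ((A.filter fun n => ¬ p n).filter fun n => f n = b).eq_empty_or_nonempty with
        he | ⟨n₀, hn₀⟩
      · rw [he, Finset.card_empty, Nat.cast_zero]
        positivity
      have hn₀A := (Finset.mem_filter.1 (Finset.mem_filter.1 hn₀).1).1
      have hn₀p := (Finset.mem_filter.1 (Finset.mem_filter.1 hn₀).1).2
      have hex : ∃ m ∈ A, ((n₀ : ZMod 4) + m ≠ 0) ∧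
          ∀ q, oddResidue K n₀ q + oddResidue K m q ≠ 0 := by
        by_contra! hc
        refine hn₀p (Finset.mem_filter.2 ⟨mem_residueClasses_of_mem K hn₀A, ?_⟩)
        rintro k hk s hs
        obtain ⟨m, hm, rfl, rfl⟩ := mem_residueClasses.1 hs
        exact hc m hm hk
      obtain ⟨m, hm, hm4, hmq⟩ := hex
      have hcong : ∀ n ∈ (A.filter fun n => ¬ p n).filter fun n => f n = b,
          (n : ZMod 4) = n₀ ∧ oddResidue K n = oddResidue K n₀ := by
        intro n hn
        have e := (Finset.mem_filter.1 hn).2.trans (Finset.mem_filter.1 hn₀).2.symm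
        simpa only [f, Prod.mk.injEq] using e
      refine card_le_of_large_prime_sq_dvd (m := m) hK
        (fun n hn => (hA n (Finset.mem_filter.1 (Finset.mem_filter.1 hn).1).1).2) (hA m hm).2
        (fun n hn n' hn' => ?_) (fun n hn => ?_)
        (fun n hn => (hA n (Finset.mem_filter.1 (Finset.mem_filter.1 hn).1).1).1)
      · obtain ⟨e1, e2⟩ := hcong n hn
        obtain ⟨e3, e4⟩ := hcong n' hn'
        exact modEq_oddModulus (e1.trans e3.symm) (e2.trans e4.symm)
      · obtain ⟨e1, e2⟩ := hcong n hn
        have hnA := (Finset.mem_filter.1 (Finset.mem_filter.1 hn).1).1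
        refine exists_large_prime_sq_dvd (hsq _ (Finset.add_mem_add hnA hm)) ?_ fun q => ?_
        · push_cast
          rwa [e1]
        · have e3 : (n : ZMod (q.1 ^ 2)) = n₀ := congrFun e2 q
          push_cast
          rw [e3]
          exact hmq q
    · rw [Finset.card_univ, Fintype.card_prod, ZMod.card, nsmul_eq_mul]
      have : Fintype.card (OddResidues K) = oddModulus K := rfl
      rw [this]
      push_cast
      field_simp

/-- Each failed alternative supplies one hypothesis of `IsResidueCore.sum_card_le`: an element
outside 4ℕ is a partner for class 0, one outside 4ℕ + 2 a partner for class 2, and one outside 9ℕ is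
nonzero modulo 9. -/
theorem sum_card_residueCore_le {K : ℕ} (hK : 7 ≤ K) {A : Finset ℕ}
    (h1 : ¬ IsOfTrivialType A) (h2 : ¬ IsOfTwoClassType A) :
    ∑ j, ((residueCore K A j).card : ℝ) ≤ (1 - oddSquarefreeDensity) * oddModulus K + 3 := by
  unfold IsOfTrivialType at h1
  push Not at h1
  obtain ⟨⟨a, ha, ha4⟩, ⟨b, hb, hb9⟩, ⟨c, hc, hc2⟩⟩ := h1
  refine (isResidueCore_residueCore K A).sum_card_le hK ?_ ?_ ?_ ?_
  · refine ⟨_, mem_compatible_of_mem ?_ (mem_residueClasses_of_mem K ha)⟩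
    rw [zero_add]
    exact fun h => ha4 ((ZMod.natCast_eq_zero_iff _ _).1 h)
  · refine ⟨_, mem_compatible_of_mem ?_ (mem_residueClasses_of_mem K hc)⟩
    intro h
    have key : ∀ k : ZMod 4, 2 + k = 0 → k = 2 := by decide
    exact hc2 ((ZMod.natCast_eq_natCast_iff c 2 4).1 (by exact_mod_cast key _ h))
  · exact ⟨_, _, mem_residueClasses_of_mem K hb,
      fun h => hb9 ((ZMod.natCast_eq_zero_iff b 9).1 h)⟩
  · intro he1 he3 s hs0 hs2 hs0'
    apply h2
    have hcase : ∀ n ∈ A, ((n : ZMod 4) = 0 ∧ (n : ZMod 9) = -s) ∨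
        ((n : ZMod 4) = 2 ∧ (n : ZMod 9) = s) := by
      intro n hn
      have hmem := mem_residueClasses_of_mem K hn
      have key : ∀ k : ZMod 4, k = 0 ∨ k = 1 ∨ k = 2 ∨ k = 3 := by decide
      rcases key n with h | h | h | h
      · rw [h] at hmem
        exact Or.inl ⟨h, hs0' _ hmem⟩
      · rw [h, he1] at hmem
        simp at hmem
      · rw [h] at hmem
        exact Or.inr ⟨h, hs2 _ hmem⟩
      · rw [h, he3] at hmem
        simp at hmem
    have key : ∀ s : ZMod 9, s ≠ 0 → ∃ a ∈ Finset.Icc (1 : ℤ) 8, (a : ZMod 9) = s := by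
      decide
    obtain ⟨a, ha, has⟩ := key s hs0
    have hne : ∀ s : ZMod 9, s ≠ 0 → s ≠ -s := by decide
    have hne' : (a : ZMod 9) ≠ -(a : ZMod 9) := by
      rw [has]
      exact hne s hs0
    have h02 : (0 : ZMod 4) ≠ 2 := by decide
    refine ⟨fun n hn => ?_, a, ha, fun n hn => ?_⟩
    · have : (n : ZMod 4) = 0 ∨ (n : ZMod 4) = 2 := (hcase n hn).imp And.left And.left
      rw [even_iff_two_dvd]
      rcases this with h | h
      · exact dvd_trans (by norm_num) ((ZMod.natCast_eq_zero_iff _ _).1 h)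
      · have : n ≡ 2 [MOD 4] := (ZMod.natCast_eq_natCast_iff n 2 4).1 (by exact_mod_cast h)
        unfold Nat.ModEq at this
        omega
    · have e4 : ∀ a b : ℤ, a ≡ b [ZMOD 4] ↔ (a : ZMod 4) = b := fun a b =>
        (ZMod.intCast_eq_intCast_iff a b 4).symm
      have e9 : ∀ a b : ℤ, a ≡ b [ZMOD 9] ↔ (a : ZMod 9) = b := fun a b =>
        (ZMod.intCast_eq_intCast_iff a b 9).symm
      rw [e4, e4, e9, e9]
      have hcn : ((n : ZMod 4) = 0 ∧ (n : ZMod 9) = -(a : ZMod 9)) ∨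
        ((n : ZMod 4) = 2 ∧ (n : ZMod 9) = (a : ZMod 9)) := by
        rw [has]
        exact hcase n hn
      push_cast
      rcases hcn with ⟨h, h'⟩ | ⟨h, h'⟩
      · rw [h, h']
        exact ⟨⟨fun e => absurd e h02, fun e => absurd e.symm hne'⟩, by simp⟩
      · rw [h, h']
        exact ⟨by simp, ⟨fun e => absurd e.symm h02, fun e => absurd e hne'⟩⟩

/-! ### Passing to the limit: the thresholds δ₀ and δ₁ -/

theorem four_mul_delta0 : 4 * delta0 = 1 - oddSquarefreeDensity := by
  unfold delta0 oddSquarefreeDensity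
  ring

theorem add_mul_sqrt_le {D ε x : ℝ} (hD : 1 ≤ D) (hε : 0 < ε) (hx : (6 * D / ε) ^ 2 ≤ x)
    (hx1 : 1 ≤ x) : D + D * Real.sqrt (2 * x) ≤ ε / 2 * x := by
  have h1 : 6 * D / ε ≤ Real.sqrt x := Real.le_sqrt_of_sq_le hx
  have h2 : 1 ≤ Real.sqrt x := Real.one_le_sqrt.2 hx1
  have h3 : Real.sqrt 2 ≤ 2 := by
    rw [Real.sqrt_le_left (by norm_num)]
    norm_num
  rw [Real.sqrt_mul (by norm_num)]
  rw [div_le_iff₀ hε] at h1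
  have h4 : Real.sqrt x * Real.sqrt x = x := Real.mul_self_sqrt (by linarith)
  have h5 : D * (Real.sqrt 2 * Real.sqrt x) ≤ D * (2 * Real.sqrt x) := by gcongr
  nlinarith [mul_le_mul_of_nonneg_right h1 (Real.sqrt_nonneg x)]

/-- The structure of sets of density greater than `δ₀`. -/
theorem exists_forall_isOfTrivialType_or_isOfTwoClassType {ε : ℝ} (hε : 0 < ε) :
    ∃ x₀ : ℝ, ∀ x : ℝ, x₀ < x → ∀ A : Finset ℕ, (∀ n ∈ A, 1 ≤ n ∧ (n : ℝ) ≤ x) →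
      (∀ m ∈ A + A, ¬ Squarefree m) → (delta0 + ε) * x < (A.card : ℝ) →
      IsOfTrivialType A ∨ IsOfTwoClassType A := by
  -- K is prime so that K² divides V, whence 3x/(4V) ≤ x/K. With 1/K ≤ ε/4 the errors are ε/4 from
  -- the additive 3, ε/4 from large primes, and ε/2 from rounding and square roots.
  obtain ⟨K, hK, hKp⟩ := Nat.exists_infinite_primes (max 7 (⌈4 / ε⌉₊ + 1))
  have hK7 : 7 ≤ K := (le_max_left _ _).trans hK
  have hKε : 4 / ε ≤ K := (Nat.le_ceil _).trans
    (by exact_mod_cast ((Nat.le_succ _).trans (le_max_right _ _)).trans hK)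
  have hV : (0 : ℝ) < oddModulus K := by exact_mod_cast oddModulus_pos K
  have hVK : (K : ℝ) ^ 2 ≤ oddModulus K := by
    have : K ^ 2 ≤ oddModulus K := by
      refine Nat.le_of_dvd (oddModulus_pos K) ?_
      rw [oddModulus_eq_prod]
      exact Finset.dvd_prod_of_mem (fun q : OddPrime K => q.1 ^ 2)
        (Finset.mem_univ (OddPrime.mk' K K hKp (by omega) le_rfl))
    exact_mod_cast this
  have hKpos : (7 : ℝ) ≤ K := by exact_mod_cast hK7
  set D : ℝ := 4 * oddModulus K with hD
  refine ⟨max 1 ((6 * D / ε) ^ 2), fun x hx A hA hsq hcard => ?_⟩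
  have hx1 : 1 ≤ x := ((le_max_left _ _).trans_lt hx).le
  have hx2 : (6 * D / ε) ^ 2 ≤ x := ((le_max_right _ _).trans_lt hx).le
  by_contra hcon
  rw [not_or] at hcon
  have h1 := card_le_sum_card_residueCore (K := K) (N := ⌊x⌋₊) (by omega) (A := A)
    (fun n hn => ⟨(hA n hn).1, Nat.le_floor (hA n hn).2⟩) hsq
  have h2 := sum_card_residueCore_le hK7 hcon.1 hcon.2
  rw [← four_mul_delta0] at h2
  have hNx : (⌊x⌋₊ : ℝ) ≤ x := Nat.floor_le (by linarith)
  have hδ : 4 * delta0 < 1 / 4 := by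
    rw [four_mul_delta0]
    linarith [oddSquarefreeDensity_gt]
  have hD1 : 196 ≤ D := by nlinarith
  have hDpos : 0 < D := by linarith
  have h3 := add_mul_sqrt_le (by linarith) hε hx2 hx1
  have hδ0 : 0 ≤ 4 * delta0 := by
    rw [four_mul_delta0]
    linarith [oddSquarefreeDensity_lt]
  have h4 : (A.card : ℝ) ≤ (4 * delta0 * oddModulus K + 3) * (x / D + 1) +
      (x * (K : ℝ)⁻¹ + D * Real.sqrt (2 * x)) := by
    refine h1.trans ?_
    gcongr
  have h5 : (4 * delta0 * oddModulus K + 3) * (x / D + 1) ≤ delta0 * x + 3 * (x / D) + D := by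
    have e : 4 * delta0 * (oddModulus K : ℝ) * (x / D) = delta0 * x := by
      rw [hD]
      field_simp
    nlinarith
  have h6 : 3 * (x / D) ≤ x * (K : ℝ)⁻¹ := by
    rw [← div_eq_mul_inv, ← mul_div_assoc, div_le_div_iff₀ hDpos (by linarith)]
    have h3K : 3 * (K : ℝ) ≤ D := by nlinarith
    nlinarith
  have h7 : x * (K : ℝ)⁻¹ ≤ ε / 4 * x := by
    rw [mul_comm]
    refine mul_le_mul_of_nonneg_right ?_ (by linarith)
    rw [inv_le_comm₀ (by linarith) (by positivity), inv_div]
    exact hKε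
  linarith

/-- Each of the two classes modulo 4 comes with one class modulo 9, so the set meets at most two
classes modulo 36. -/
theorem card_le_of_isOfTwoClassType {A : Finset ℕ} {N : ℕ} (hN : ∀ n ∈ A, n ≤ N)
    (h : IsOfTwoClassType A) : (A.card : ℝ) ≤ N / 18 + 2 := by
  obtain ⟨heven, a, -, ha⟩ := h
  rw [← Finset.card_filter_add_card_filter_not (fun n : ℕ => (n : ℤ) ≡ 0 [ZMOD 4]),
    Nat.cast_add]
  have h36 : ∀ n m : ℕ, (n : ℤ) ≡ m [ZMOD 4] → (n : ℤ) ≡ m [ZMOD 9] → n ≡ m [MOD 36] := by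
    intro n m h4 h9
    exact (Nat.modEq_and_modEq_iff_modEq_mul (by norm_num : Nat.Coprime 4 9)).1
      ⟨Int.natCast_modEq_iff.1 h4, Int.natCast_modEq_iff.1 h9⟩
  have h0 := card_le_div_add_one_of_modEq (N := N) (L := 36)
    (S := A.filter fun n : ℕ => (n : ℤ) ≡ 0 [ZMOD 4])
    (fun n hn => hN n (Finset.mem_filter.1 hn).1) (by
      intro n hn m hm
      rw [Finset.mem_filter] at hn hm
      exact h36 n m (hn.2.trans hm.2.symm)
        (((ha n hn.1).2.1 hn.2).trans ((ha m hm.1).2.1 hm.2).symm))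
  have h2 := card_le_div_add_one_of_modEq (N := N) (L := 36)
    (S := A.filter fun n : ℕ => ¬ (n : ℤ) ≡ 0 [ZMOD 4])
    (fun n hn => hN n (Finset.mem_filter.1 hn).1) (by
      have key : ∀ n ∈ A, ¬ (n : ℤ) ≡ 0 [ZMOD 4] → (n : ℤ) ≡ 2 [ZMOD 4] := by
        intro n hn h
        obtain ⟨k, hk⟩ := heven n hn
        unfold Int.ModEq at h ⊢
        omega
      intro n hn m hm
      rw [Finset.mem_filter] at hn hm
      have hn2 := key n hn.1 hn.2
      have hm2 := key m hm.1 hm.2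
      exact h36 n m (hn2.trans hm2.symm)
        (((ha n hn.1).1.1 hn2).trans ((ha m hm.1).1.1 hm2).symm))
  push_cast at h0 h2
  linarith

/-- The structure of sets of density greater than `δ₁`. -/
theorem exists_forall_isOfTrivialType {ε : ℝ} (hε : 0 < ε) :
    ∃ x₀ : ℝ, ∀ x : ℝ, x₀ < x → ∀ A : Finset ℕ, (∀ n ∈ A, 1 ≤ n ∧ (n : ℝ) ≤ x) →
      (∀ m ∈ A + A, ¬ Squarefree m) → (delta1 + ε) * x < (A.card : ℝ) →
      IsOfTrivialType A := by
  obtain ⟨x₀, hx₀⟩ := exists_forall_isOfTrivialType_or_isOfTwoClassType hε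
  refine ⟨max x₀ (max 1 (2 / ε)), fun x hx A hA hsq hcard => ?_⟩
  have hx1 : 1 ≤ x := ((le_max_left _ _).trans (le_max_right _ _)).trans hx.le
  have hxε : 2 / ε ≤ x := ((le_max_right _ _).trans (le_max_right _ _)).trans hx.le
  have hδ : delta0 ≤ delta1 := by
    have := four_mul_delta0
    have := oddSquarefreeDensity_gt
    unfold delta1
    linarith
  rcases hx₀ x ((le_max_left _ _).trans_lt hx) A hA hsq (by nlinarith) with h | h
  · exact h
  · exfalso
    have h1 := card_le_of_isOfTwoClassType (N := ⌊x⌋₊) (fun n hn => Nat.le_floor (hA n hn).2) h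
    have h2 : (⌊x⌋₊ : ℝ) ≤ x := Nat.floor_le (by linarith)
    rw [div_le_iff₀ hε] at hxε
    unfold delta1 at hcard
    linarith

open scoped symmDiff

/-! ### Almost periodic sets of natural numbers -/

/-- The number of elements of `S` in `[1, N]`. -/
noncomputable def countUpTo (S : Set ℕ) (N : ℕ) : ℝ := ((S ∩ Set.Icc 1 N).ncard : ℝ)

theorem countUpTo_mono {S T : Set ℕ} {N : ℕ} (h : ∀ n ∈ S, 1 ≤ n → n ≤ N → n ∈ T) :
    countUpTo S N ≤ countUpTo T N := by
  have hsub : S ∩ Set.Icc 1 N ⊆ T ∩ Set.Icc 1 N := fun n hn =>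
    ⟨h n hn.1 hn.2.1 hn.2.2, hn.2⟩
  exact Nat.cast_le.2 (Set.ncard_le_ncard hsub ((Set.finite_Icc 1 N).inter_of_right _))

theorem countUpTo_union_le (S T : Set ℕ) (N : ℕ) :
    countUpTo (S ∪ T) N ≤ countUpTo S N + countUpTo T N := by
  unfold countUpTo
  rw [Set.union_inter_distrib_right]
  exact_mod_cast Set.ncard_union_le _ _

theorem countUpTo_nonneg (S : Set ℕ) (N : ℕ) : 0 ≤ countUpTo S N := Nat.cast_nonneg _

theorem countUpTo_le (S : Set ℕ) (N : ℕ) : countUpTo S N ≤ N := by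
  unfold countUpTo
  have h := Set.ncard_le_ncard (Set.inter_subset_right (s := S)) (Set.finite_Icc 1 N)
  rw [Set.ncard_Icc_nat, Nat.add_sub_cancel] at h
  exact_mod_cast h

theorem countUpTo_le_ncard {S : Set ℕ} (hS : S.Finite) (N : ℕ) : countUpTo S N ≤ S.ncard := by
  unfold countUpTo
  exact_mod_cast Set.ncard_le_ncard Set.inter_subset_left hS

theorem countUpTo_eq_card (S : Set ℕ) [DecidablePred (· ∈ S)] (N : ℕ) :
    countUpTo S N = (((Finset.Icc 1 N).filter (· ∈ S)).card : ℝ) := by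
  unfold countUpTo
  rw [← Set.ncard_coe_finset]
  congr 2
  ext n
  rw [Finset.mem_coe, Finset.mem_filter, Finset.mem_Icc, Set.mem_inter_iff, Set.mem_Icc, and_comm]

theorem abs_countUpTo_sub_le (S T : Set ℕ) (N : ℕ) :
    |countUpTo S N - countUpTo T N| ≤ countUpTo (S ∆ T) N := by
  have h1 : countUpTo S N ≤ countUpTo (T ∪ S ∆ T) N := countUpTo_mono fun n hn _ _ => by
    by_cases h : n ∈ T
    · exact Or.inl h
    · exact Or.inr (Or.inl ⟨hn, h⟩)
  have h2 : countUpTo T N ≤ countUpTo (S ∪ S ∆ T) N := countUpTo_mono fun n hn _ _ => by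
    by_cases h : n ∈ S
    · exact Or.inl h
    · exact Or.inr (Or.inr ⟨hn, h⟩)
  have h3 := countUpTo_union_le T (S ∆ T) N
  have h4 := countUpTo_union_le S (S ∆ T) N
  rw [abs_le]
  constructor <;> linarith

theorem countUpTo_add_of_periodic {P : Set ℕ} {W : ℕ} (hP : ∀ n, n + W ∈ P ↔ n ∈ P) (N : ℕ) :
    countUpTo P (N + W) = countUpTo P N + countUpTo P W := by
  have h : P ∩ Set.Icc 1 (N + W) =
      (P ∩ Set.Icc 1 W) ∪ (fun n => n + W) '' (P ∩ Set.Icc 1 N) := by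
    ext n
    simp only [Set.mem_inter_iff, Set.mem_Icc, Set.mem_union, Set.mem_image]
    constructor
    · rintro ⟨h1, h2, h3⟩
      by_cases hn : n ≤ W
      · exact Or.inl ⟨h1, h2, hn⟩
      · refine Or.inr ⟨n - W, ⟨?_, by omega, by omega⟩, by omega⟩
        rw [← hP, Nat.sub_add_cancel (by omega)]
        exact h1
    · rintro (⟨h1, h2, h3⟩ | ⟨m, ⟨h1, h2, h3⟩, rfl⟩)
      · exact ⟨h1, h2, by omega⟩
      · exact ⟨(hP m).2 h1, by omega, by omega⟩
  unfold countUpTo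
  rw [h, Set.ncard_union_eq ?_ ((Set.finite_Icc 1 W).inter_of_right _)
    (((Set.finite_Icc 1 N).inter_of_right _).image _),
    Set.ncard_image_of_injective _ (add_left_injective W)]
  · push_cast
    ring
  · rw [Set.disjoint_left]
    rintro n ⟨-, -, h1⟩ ⟨m, ⟨-, h2, -⟩, rfl⟩
    dsimp only at h1
    omega

theorem countUpTo_mul_add_of_periodic {P : Set ℕ} {W : ℕ} (hP : ∀ n, n + W ∈ P ↔ n ∈ P)
    (k r : ℕ) : countUpTo P (W * k + r) = k * countUpTo P W + countUpTo P r := by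
  induction k with
  | zero => simp
  | succ k ih =>
    rw [show W * (k + 1) + r = W * k + r + W by ring, countUpTo_add_of_periodic hP, ih]
    push_cast
    ring

theorem tendsto_countUpTo_of_periodic {P : Set ℕ} {W : ℕ} (hW : 0 < W)
    (hP : ∀ n, n + W ∈ P ↔ n ∈ P) :
    Tendsto (fun N : ℕ => countUpTo P N / N) atTop (𝓝 (countUpTo P W / W)) := by
  rw [tendsto_iff_norm_sub_tendsto_zero]
  have hz : Tendsto (fun N : ℕ => (W : ℝ) / N) atTop (𝓝 0) :=
    tendsto_const_div_atTop_nhds_zero_nat _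
  refine squeeze_zero' (Eventually.of_forall fun _ => norm_nonneg _) ?_ hz
  filter_upwards [eventually_gt_atTop 0] with N hN
  have hN' : (0 : ℝ) < N := by exact_mod_cast hN
  have hW' : (0 : ℝ) < W := by exact_mod_cast hW
  have h1 := countUpTo_mul_add_of_periodic hP (N / W) (N % W)
  rw [Nat.div_add_mod] at h1
  have h2 : (N : ℝ) = W * (N / W : ℕ) + (N % W : ℕ) := by
    exact_mod_cast (Nat.div_add_mod N W).symm
  have h3 : ((N % W : ℕ) : ℝ) ≤ W := by exact_mod_cast (Nat.mod_lt N hW).le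
  have h4 := countUpTo_le P (N % W)
  have h5 := countUpTo_le P W
  have h6 := countUpTo_nonneg P (N % W)
  have h7 := countUpTo_nonneg P W
  have h8 : countUpTo P W / W ≤ 1 := by
    rw [div_le_one hW']
    exact h5
  have h9 : 0 ≤ countUpTo P W / W := by positivity
  have e : countUpTo P N / N - countUpTo P W / W =
      (countUpTo P (N % W) - countUpTo P W / W * (N % W : ℕ)) / N := by
    rw [h1]
    rw [eq_div_iff hN'.ne', sub_mul, div_mul_cancel₀ _ hN'.ne']
    rw [h2]
    field_simp
    ring
  rw [e, Real.norm_eq_abs, abs_div, abs_of_pos hN']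
  have hr : (0 : ℝ) ≤ (N % W : ℕ) := Nat.cast_nonneg _
  gcongr
  rw [abs_le]
  constructor <;> nlinarith

/-- `S` can be approximated arbitrarily well, in upper density, by periodic sets. -/
def IsAlmostPeriodic (S : Set ℕ) : Prop :=
  ∀ η : ℝ, 0 < η → ∃ P : Set ℕ, ∃ W : ℕ, 0 < W ∧ (∀ n, n + W ∈ P ↔ n ∈ P) ∧
    ∀ᶠ N : ℕ in atTop, countUpTo (S ∆ P) N ≤ η * N

theorem exists_tendsto_of_forall_exists_approx (u : ℕ → ℝ)
    (h : ∀ η : ℝ, 0 < η → ∃ v : ℕ → ℝ, ∃ l, Tendsto v atTop (𝓝 l) ∧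
      ∀ᶠ N in atTop, |u N - v N| ≤ η) : ∃ d, Tendsto u atTop (𝓝 d) := by
  refine cauchySeq_tendsto_of_complete ?_
  rw [Metric.cauchySeq_iff']
  intro η hη
  obtain ⟨v, l, hv, huv⟩ := h (η / 8) (by positivity)
  have h2 := (Metric.tendsto_nhds.1 hv (η / 8) (by positivity)).and huv
  obtain ⟨N, hN⟩ := eventually_atTop.1 h2
  refine ⟨N, fun n hn => ?_⟩
  obtain ⟨a1, a2⟩ := hN n hn
  obtain ⟨b1, b2⟩ := hN N le_rfl
  rw [Real.dist_eq] at a1 b1 ⊢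
  rw [abs_lt] at *
  rw [abs_le] at *
  constructor <;> linarith

/-- The counting ratios stay eventually within any η of a convergent sequence, so they are Cauchy.
-/
theorem IsAlmostPeriodic.exists_hasNatDensity {S : Set ℕ} (hS : IsAlmostPeriodic S) :
    ∃ d, HasNatDensity S d := by
  refine exists_tendsto_of_forall_exists_approx _ fun η hη => ?_
  obtain ⟨P, W, hW, hP, hSP⟩ := hS η hη
  refine ⟨_, _, tendsto_countUpTo_of_periodic hW hP, ?_⟩
  filter_upwards [hSP, eventually_gt_atTop 0] with N h1 hN
  have hN' : (0 : ℝ) < N := by exact_mod_cast hN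
  change |countUpTo S N / N - countUpTo P N / N| ≤ η
  rw [← sub_div, abs_div, abs_of_pos hN', div_le_iff₀ hN']
  exact (abs_countUpTo_sub_le S P N).trans h1

theorem IsAlmostPeriodic.of_periodic {P : Set ℕ} {W : ℕ} (hW : 0 < W)
    (hP : ∀ n, n + W ∈ P ↔ n ∈ P) : IsAlmostPeriodic P := by
  refine fun η hη => ⟨P, W, hW, hP, Eventually.of_forall fun N => ?_⟩
  rw [symmDiff_self]
  simp only [countUpTo, Set.bot_eq_empty, Set.empty_inter, Set.ncard_empty, Nat.cast_zero]
  positivity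

theorem IsAlmostPeriodic.compl {S : Set ℕ} (hS : IsAlmostPeriodic S) :
    IsAlmostPeriodic Sᶜ := by
  intro η hη
  obtain ⟨P, W, hW, hP, hSP⟩ := hS η hη
  refine ⟨Pᶜ, W, hW, fun n => not_congr (hP n), ?_⟩
  rwa [compl_symmDiff_compl]

theorem add_mul_mem_iff {P : Set ℕ} {W : ℕ} (hP : ∀ n, n + W ∈ P ↔ n ∈ P) (n k : ℕ) :
    n + W * k ∈ P ↔ n ∈ P := by
  induction k with
  | zero => simp
  | succ k ih => rw [Nat.mul_succ, ← add_assoc, hP, ih]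

theorem IsAlmostPeriodic.inter {S T : Set ℕ} (hS : IsAlmostPeriodic S)
    (hT : IsAlmostPeriodic T) : IsAlmostPeriodic (S ∩ T) := by
  intro η hη
  obtain ⟨P, W, hW, hP, hSP⟩ := hS (η / 2) (by positivity)
  obtain ⟨Q, U, hU, hQ, hTQ⟩ := hT (η / 2) (by positivity)
  refine ⟨P ∩ Q, W * U, by positivity, fun n => ?_, ?_⟩
  · have h1 := add_mul_mem_iff hP n U
    have h2 := add_mul_mem_iff hQ n W
    rw [mul_comm] at h2
    exact and_congr h1 h2
  · filter_upwards [hSP, hTQ] with N h1 h2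
    have h3 : countUpTo ((S ∩ T) ∆ (P ∩ Q)) N ≤ countUpTo (S ∆ P ∪ T ∆ Q) N :=
      countUpTo_mono fun n hn _ _ => by
        simp only [Set.mem_symmDiff, Set.mem_inter_iff, Set.mem_union] at hn ⊢
        tauto
    have h4 := countUpTo_union_le (S ∆ P) (T ∆ Q) N
    linarith

theorem IsAlmostPeriodic.union {S T : Set ℕ} (hS : IsAlmostPeriodic S)
    (hT : IsAlmostPeriodic T) : IsAlmostPeriodic (S ∪ T) := by
  have := (hS.compl.inter hT.compl).compl
  rwa [← Set.compl_union, compl_compl] at this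

theorem IsAlmostPeriodic.forall_mem_finset {ι : Type*} (s : Finset ι) {p : ι → ℕ → Prop}
    (h : ∀ i ∈ s, IsAlmostPeriodic {n | p i n}) : IsAlmostPeriodic {n | ∀ i ∈ s, p i n} := by
  classical
  induction s using Finset.induction_on with
  | empty =>
    exact IsAlmostPeriodic.of_periodic one_pos (by simp)
  | insert a s _ ih =>
    have h1 := (h a (Finset.mem_insert_self _ _)).inter
      (ih fun i hi => h i (Finset.mem_insert_of_mem hi))
    convert h1 using 1
    ext n
    simp

theorem IsAlmostPeriodic.exists_mem_finset {ι : Type*} (s : Finset ι) {p : ι → ℕ → Prop}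
    (h : ∀ i ∈ s, IsAlmostPeriodic {n | p i n}) : IsAlmostPeriodic {n | ∃ i ∈ s, p i n} := by
  have h1 := (IsAlmostPeriodic.forall_mem_finset s (p := fun i n => ¬ p i n)
    fun i hi => (h i hi).compl).compl
  convert h1 using 1
  ext n
  simp

theorem eventually_le_mul_natCast (C : ℝ) {η : ℝ} (hη : 0 < η) :
    ∀ᶠ N : ℕ in atTop, C ≤ η * N :=
  (tendsto_natCast_atTop_atTop.const_mul_atTop hη).eventually_ge_atTop C

theorem IsAlmostPeriodic.congr_of_forall_ge {S T : Set ℕ} (hS : IsAlmostPeriodic S) (M : ℕ)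
    (h : ∀ n, M ≤ n → (n ∈ S ↔ n ∈ T)) : IsAlmostPeriodic T := by
  intro η hη
  obtain ⟨P, W, hW, hP, hSP⟩ := hS (η / 2) (by positivity)
  refine ⟨P, W, hW, hP, ?_⟩
  filter_upwards [hSP, eventually_le_mul_natCast ((Set.Iio M).ncard : ℝ) (half_pos hη)]
    with N h1 h2
  have h3 : countUpTo (T ∆ P) N ≤ countUpTo (S ∆ P ∪ Set.Iio M) N :=
    countUpTo_mono fun n hn _ _ => by
      by_cases hM : M ≤ n
      · left
        have := h n hM
        simp only [Set.mem_symmDiff] at hn ⊢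
        tauto
      · exact Or.inr (not_le.1 hM)
  have h4 := countUpTo_union_le (S ∆ P) (Set.Iio M) N
  have h5 := countUpTo_le_ncard (Set.finite_Iio M) N
  linarith

/-! ### Shifts of the set of squarefree numbers -/

theorem Int.not_squarefree_iff_exists_prime {z : ℤ} :
    ¬ Squarefree z ↔ ∃ q : ℕ, q.Prime ∧ (q : ℤ) ^ 2 ∣ z := by
  rw [← Int.squarefree_natAbs, Nat.squarefree_iff_prime_squarefree]
  push Not
  refine exists_congr fun q => and_congr_right fun _ => ?_
  rw [← Int.natCast_dvd]
  push_cast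
  rw [sq]

/-- The progressions modulo q², q > K, have total density at most 1/K; the strict inequality 1/K < η
absorbs the rounding error of order √N. -/
theorem eventually_countUpTo_large_prime_sq_le {K : ℕ} (hK : K ≠ 0) (c : ℤ) {η : ℝ}
    (hη : (K : ℝ)⁻¹ < η) :
    ∀ᶠ N : ℕ in atTop,
      countUpTo {n : ℕ | ∃ q : ℕ, q.Prime ∧ K < q ∧ (q : ℤ) ^ 2 ∣ n + c} N ≤ η * N := by
  classical
  have hsqrt : ∀ᶠ N : ℕ in atTop,
      Real.sqrt (N + c.natAbs) + 1 ≤ (η - (K : ℝ)⁻¹) * N := by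
    have hδ : 0 < η - (K : ℝ)⁻¹ := by linarith
    filter_upwards [eventually_le_mul_natCast ((η - (K : ℝ)⁻¹) / 4 * c.natAbs +
      (η - (K : ℝ)⁻¹)⁻¹ + 1) (half_pos hδ)] with N h1
    generalize η - (K : ℝ)⁻¹ = δ at *
    have hy : (0 : ℝ) ≤ N + c.natAbs := by positivity
    have h2 := Real.sq_sqrt hy
    have h3 : δ * δ⁻¹ = 1 := mul_inv_cancel₀ hδ.ne'
    -- This is (δ√y/2 - 1)² ≥ 0 with y = N + |c|, divided by δ.
    have h4 : Real.sqrt (N + c.natAbs) ≤ δ / 4 * (N + c.natAbs) + δ⁻¹ := by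
      have h5 : δ * (δ / 4 * (N + c.natAbs) + δ⁻¹ - Real.sqrt (N + c.natAbs)) =
          (δ / 2 * Real.sqrt (N + c.natAbs) - 1) ^ 2 := by
        rw [sub_sq, mul_pow, h2]
        linear_combination h3
      have h6 : 0 ≤ δ / 4 * (N + c.natAbs) + δ⁻¹ - Real.sqrt (N + c.natAbs) :=
        nonneg_of_mul_nonneg_right (h5 ▸ sq_nonneg _) hδ
      linarith
    have hN0 : 0 ≤ δ * N := mul_nonneg hδ.le (Nat.cast_nonneg N)
    linarith
  filter_upwards [hsqrt] with N hN
  let M := Nat.sqrt (N + c.natAbs)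
  have hsub : countUpTo {n : ℕ | ∃ q : ℕ, q.Prime ∧ K < q ∧ (q : ℤ) ^ 2 ∣ n + c} N ≤
      -- The integer n with n + c = 0 is set apart: it is divisible by every square, so the bound q²
      -- ≤ N + |c| fails for it.
      ((insert (-c).toNat ((Finset.Ioc K M).biUnion fun q =>
        (Finset.Icc 1 N).filter fun n : ℕ => (q : ℤ) ^ 2 ∣ n + c)).card : ℝ) := by
    rw [countUpTo_eq_card]
    refine Nat.cast_le.2 (Finset.card_le_card fun n hn => ?_)
    obtain ⟨hn1, q, -, hKq, hq⟩ := Finset.mem_filter.1 hn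
    rw [Finset.mem_insert]
    by_cases h0 : (n : ℤ) + c = 0
    · left
      omega
    · right
      refine Finset.mem_biUnion.2 ⟨q, Finset.mem_Ioc.2 ⟨hKq, ?_⟩,
        Finset.mem_filter.2 ⟨hn1, hq⟩⟩
      rw [Nat.le_sqrt']
      have h1 := Int.natAbs_le_of_dvd_ne_zero hq h0
      rw [Int.natAbs_pow, Int.natAbs_natCast] at h1
      have := (Finset.mem_Icc.1 hn1).2
      omega
  have hpart : ∀ q ∈ Finset.Ioc K M,
      (((Finset.Icc 1 N).filter fun n : ℕ => (q : ℤ) ^ 2 ∣ n + c).card : ℝ) ≤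
        N * ((q : ℝ) ^ 2)⁻¹ + 1 := by
    intro q hq
    have h1 := card_le_div_add_one_of_modEq (N := N) (L := q ^ 2)
      (S := (Finset.Icc 1 N).filter fun n : ℕ => (q : ℤ) ^ 2 ∣ n + c)
      (fun n hn => (Finset.mem_Icc.1 (Finset.mem_filter.1 hn).1).2)
      (fun n hn m hm => by
        rw [Nat.modEq_iff_dvd]
        have := dvd_sub (Finset.mem_filter.1 hm).2 (Finset.mem_filter.1 hn).2
        push_cast
        simpa using this)
    rw [div_eq_mul_inv] at h1
    exact_mod_cast h1
  have hsum := sum_Ioc_inv_sq_le hK M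
  calc countUpTo {n : ℕ | ∃ q : ℕ, q.Prime ∧ K < q ∧ (q : ℤ) ^ 2 ∣ n + c} N
      ≤ ((Finset.Ioc K M).biUnion fun q =>
        (Finset.Icc 1 N).filter fun n : ℕ => (q : ℤ) ^ 2 ∣ n + c).card + 1 :=
        hsub.trans (by exact_mod_cast Finset.card_insert_le _ _)
    _ ≤ ∑ q ∈ Finset.Ioc K M,
        (((Finset.Icc 1 N).filter fun n : ℕ => (q : ℤ) ^ 2 ∣ n + c).card : ℝ) + 1 := by
        gcongr
        exact_mod_cast Finset.card_biUnion_le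
    _ ≤ ∑ q ∈ Finset.Ioc K M, (N * ((q : ℝ) ^ 2)⁻¹ + 1) + 1 := by
        gcongr with q hq
        exact hpart q hq
    _ = N * ∑ q ∈ Finset.Ioc K M, ((q : ℝ) ^ 2)⁻¹ + ((M - K : ℕ) : ℝ) + 1 := by
        rw [Finset.sum_add_distrib, Finset.mul_sum]
        simp
    _ ≤ N * (K : ℝ)⁻¹ + Real.sqrt (N + c.natAbs) + 1 := by
        gcongr
        have h1 : ((M - K : ℕ) : ℝ) ≤ M := by exact_mod_cast Nat.sub_le _ _
        refine h1.trans (Real.le_sqrt_of_sq_le ?_)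
        exact_mod_cast Nat.sqrt_le' (N + c.natAbs)
    _ ≤ η * N := by linarith

/-- Testing only the squares of primes up to K gives a periodic set; the error consists of shifts
divisible by a larger prime square, of density at most 1/K. -/
theorem IsAlmostPeriodic.not_squarefree_add (c : ℤ) :
    IsAlmostPeriodic {n : ℕ | ¬ Squarefree ((n : ℤ) + c)} := by
  intro η hη
  obtain ⟨K, hK⟩ := exists_nat_gt η⁻¹
  have hK0 : (0 : ℝ) < K := (by positivity : 0 < η⁻¹).trans hK
  have hKη : (K : ℝ)⁻¹ < η := (inv_lt_comm₀ hK0 hη).2 hK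
  let W := ∏ q ∈ (Finset.range (K + 1)).filter Nat.Prime, q ^ 2
  refine ⟨{n | ∃ q ∈ (Finset.range (K + 1)).filter Nat.Prime, (q : ℤ) ^ 2 ∣ n + c}, W, ?_, ?_, ?_⟩
  · exact Finset.prod_pos fun q hq => by
      have := (Finset.mem_filter.1 hq).2.pos
      positivity
  · intro n
    refine exists_congr fun q => and_congr_right fun hq => ?_
    have h1 : (q : ℤ) ^ 2 ∣ (W : ℤ) := by
      have : q ^ 2 ∣ W := Finset.dvd_prod_of_mem (fun q : ℕ => q ^ 2) hq
      exact_mod_cast this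
    push_cast
    rw [show (n : ℤ) + W + c = n + c + W by ring]
    exact dvd_add_left h1
  · filter_upwards [eventually_countUpTo_large_prime_sq_le (by rintro rfl; simp at hK0) c hKη]
      with N hN
    refine (countUpTo_mono fun n hn _ _ => ?_).trans hN
    rw [Set.mem_symmDiff, Set.mem_ofPred_eq, Set.mem_ofPred_eq,
      Int.not_squarefree_iff_exists_prime] at hn
    rcases hn with ⟨⟨q, hq, hqn⟩, h2⟩ | ⟨⟨q, hq, hqn⟩, h2⟩
    · refine ⟨q, hq, ?_, hqn⟩
      by_contra hqK
      exact h2 ⟨q, Finset.mem_filter.2 ⟨Finset.mem_range.2 (by omega), hq⟩, hqn⟩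
    · exact absurd ⟨q, (Finset.mem_filter.1 hq).2, hqn⟩ h2

/-! ### A set whose sumset contains almost all non-squarefree numbers -/

/-- The multiples `n` of `4` such that `n + V`, `n + 2 * V`, `n + 3 * V` are not squarefree. -/
def shiftedNonsquarefree (V : ℕ) : Set ℕ :=
  {n | 1 ≤ n ∧ 4 ∣ n ∧ ∀ i ∈ Finset.Icc 1 3, ¬ Squarefree (n + i * V)}

/-- The set `{V, 2 * V, 3 * V}`, together with `shiftedNonsquarefree V`. -/
def extremalSet (V : ℕ) : Set ℕ :=
  {n | ∃ i ∈ Finset.Icc 1 3, n = i * V} ∪ shiftedNonsquarefree V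

theorem not_squarefree_of_sq_dvd {q n : ℕ} (hq : 1 < q) (h : q ^ 2 ∣ n) : ¬ Squarefree n := by
  intro hn
  have := hn q (by rwa [← sq])
  rw [Nat.isUnit_iff] at this
  omega

theorem mul_mem_extremalSet {V i : ℕ} (h1 : 1 ≤ i) (h3 : i ≤ 3) : i * V ∈ extremalSet V :=
  Or.inl ⟨i, Finset.mem_Icc.2 ⟨h1, h3⟩, rfl⟩

theorem mem_shiftedNonsquarefree_of_sq_dvd {V q n : ℕ} (hq : 1 < q) (hV : q ^ 2 ∣ V)
    (hn : 1 ≤ n) (h4 : 4 ∣ n) (hqn : q ^ 2 ∣ n) : n ∈ shiftedNonsquarefree V :=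
  ⟨hn, h4, fun i _ => not_squarefree_of_sq_dvd hq (dvd_add hqn (hV.mul_left i))⟩

/-- Two multiples of V sum to a multiple of 9, two multiples of 4 to a multiple of 4, and mixed sums
are non-squarefree by the choice of `shiftedNonsquarefree`. -/
theorem not_squarefree_of_mem_extremalSet_add {V : ℕ} (h9 : 3 ^ 2 ∣ V) :
    ∀ m ∈ extremalSet V + extremalSet V, ¬ Squarefree m := by
  rintro _ ⟨a, ha, b, hb, rfl⟩
  rcases ha with ⟨i, hi, rfl⟩ | ha <;> rcases hb with ⟨j, hj, rfl⟩ | hb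
  · exact not_squarefree_of_sq_dvd (by norm_num) (dvd_add (h9.mul_left i) (h9.mul_left j))
  · dsimp only
    rw [add_comm]
    exact hb.2.2 i hi
  · exact ha.2.2 j hj
  · exact not_squarefree_of_sq_dvd (q := 2) (by norm_num) (dvd_add ha.2.1 hb.2.1)

theorem exists_add_eq_of_four_dvd {V m : ℕ} (h9 : 3 ^ 2 ∣ V) (h25 : 5 ^ 2 ∣ V) (h4 : 4 ∣ m)
    (hm : 2000 ≤ m) : ∃ a ∈ shiftedNonsquarefree V, ∃ b ∈ shiftedNonsquarefree V, a + b = m := by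
  obtain ⟨n, rfl⟩ := h4
  obtain ⟨a, b, ha, hb, hab⟩ : ∃ a b, 1 ≤ a ∧ 1 ≤ b ∧ 9 * a + 25 * b = n :=
    -- Since 25 · 4 ≡ 1 modulo 9, b ≡ 4n makes n - 25b divisible by 9. Adding 9 keeps b positive,
    -- and 25b ≤ 425 < 500 ≤ n.
    ⟨(n - 25 * (4 * n % 9 + 9)) / 9, 4 * n % 9 + 9, by omega, by omega, by omega⟩
  refine ⟨36 * a, ?_, 100 * b, ?_, by omega⟩
  · exact mem_shiftedNonsquarefree_of_sq_dvd (by norm_num) h9 (by omega) (by omega) (by omega)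
  · exact mem_shiftedNonsquarefree_of_sq_dvd (by norm_num) h25 (by omega) (by omega) (by omega)

theorem finite_compl_extremalSet_add_add {V : ℕ} (hV : V % 4 = 1) (h9 : 3 ^ 2 ∣ V)
    (h25 : 5 ^ 2 ∣ V) : (extremalSet V + extremalSet V + extremalSet V)ᶜ.Finite := by
  refine (Set.finite_Iio (3 * V + 4000)).subset fun m hm => ?_
  by_contra hlt
  rw [Set.mem_Iio, not_lt] at hlt
  refine hm ?_
  have key : ∀ c ∈ extremalSet V, c ≤ m → 4 ∣ m - c → 2000 ≤ m - c →
      m ∈ extremalSet V + extremalSet V + extremalSet V := by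
    intro c hc hcm h4 h2000
    obtain ⟨a, ha, b, hb, hab⟩ := exists_add_eq_of_four_dvd h9 h25 h4 h2000
    exact ⟨a + b, ⟨a, Or.inr ha, b, Or.inr hb, rfl⟩, c, hc, by dsimp only; omega⟩
  have hcases : m % 4 = 0 ∨ m % 4 = 1 ∨ m % 4 = 2 ∨ m % 4 = 3 := by omega
  rcases hcases with h | h | h | h
  · exact key 36 (Or.inr (mem_shiftedNonsquarefree_of_sq_dvd (q := 3) (by norm_num) h9
      (by norm_num) (by norm_num) (by norm_num))) (by omega) (by omega) (by omega)
  · exact key _ (mul_mem_extremalSet (i := 1) (by norm_num) (by norm_num)) (by omega) (by omega)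
      (by omega)
  · exact key _ (mul_mem_extremalSet (i := 2) (by norm_num) (by norm_num)) (by omega) (by omega)
      (by omega)
  · exact key _ (mul_mem_extremalSet (i := 3) (by norm_num) (by norm_num)) (by omega) (by omega)
      (by omega)

theorem isAlmostPeriodic_mod_four (r : ℕ) : IsAlmostPeriodic {n : ℕ | n % 4 = r} :=
  IsAlmostPeriodic.of_periodic (W := 4) (by norm_num) fun n => by
    rw [Set.mem_ofPred_eq, Set.mem_ofPred_eq, Nat.add_mod_right]

theorem isAlmostPeriodic_extremalSet (V : ℕ) : IsAlmostPeriodic (extremalSet V) := by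
  have h1 := (isAlmostPeriodic_mod_four 0).inter
    (IsAlmostPeriodic.forall_mem_finset (Finset.Icc 1 3) fun i (_ : i ∈ Finset.Icc 1 3) =>
      IsAlmostPeriodic.not_squarefree_add ((i * V : ℕ) : ℤ))
  refine h1.congr_of_forall_ge (3 * V + 1) fun n hn => ?_
  constructor
  · rintro ⟨h4, h⟩
    refine Or.inr ⟨by omega, Nat.dvd_of_mod_eq_zero h4, fun i hi => ?_⟩
    have := h i hi
    rwa [← Nat.cast_add, Int.squarefree_natCast] at this
  · rintro (⟨i, hi, rfl⟩ | ⟨-, h4, h⟩)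
    · have := Nat.mul_le_mul_right V (Finset.mem_Icc.1 hi).2
      omega
    · refine ⟨Nat.mod_eq_zero_of_dvd h4, fun i hi => ?_⟩
      have := h i hi
      rwa [← Nat.cast_add, Int.squarefree_natCast]

/-- Beyond 6V no sum of two multiples iV + jV occurs, and the class modulo 4 determines j in m = n +
jV. The conditions on n then become integer shifts (i - j)V of m, possibly negative, to which
`IsAlmostPeriodic.not_squarefree_add` applies. -/
theorem mem_extremalSet_add_iff {V : ℕ} (hV : V % 4 = 1) (h9 : 3 ^ 2 ∣ V) (h25 : 5 ^ 2 ∣ V)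
    {m : ℕ} (hm : 6 * V + 2000 ≤ m) :
    m ∈ extremalSet V + extremalSet V ↔ m % 4 = 0 ∨ ∃ j ∈ Finset.Icc 1 3, m % 4 = j ∧
      ∀ i ∈ Finset.Icc (1 : ℕ) 3, ¬ Squarefree ((m : ℤ) + ((i : ℤ) - j) * V) := by
  have hmod : ∀ j ∈ Finset.Icc 1 3, (j * V) % 4 = j := by
    intro j hj
    rw [Nat.mul_mod, hV, mul_one, Nat.mod_mod]
    exact Nat.mod_eq_of_lt (by have := (Finset.mem_Icc.1 hj).2; omega)
  have hle : ∀ j ∈ Finset.Icc 1 3, j * V ≤ 3 * V := fun j hj =>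
    Nat.mul_le_mul_right V (Finset.mem_Icc.1 hj).2
  have hcast : ∀ i j n : ℕ,
      ((n + j * V : ℕ) : ℤ) + ((i : ℤ) - j) * V = ((n + i * V : ℕ) : ℤ) := by
    intro i j n
    push_cast
    ring
  have hmixed : ∀ n ∈ shiftedNonsquarefree V, ∀ j ∈ Finset.Icc 1 3, n + j * V = m →
      ∃ j ∈ Finset.Icc 1 3, m % 4 = j ∧
        ∀ i ∈ Finset.Icc (1 : ℕ) 3, ¬ Squarefree ((m : ℤ) + ((i : ℤ) - j) * V) := by
    rintro n ⟨-, h4, hn⟩ j hj rfl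
    refine ⟨j, hj, ?_, fun i hi => ?_⟩
    · have := hmod j hj
      omega
    · rw [hcast, Int.squarefree_natCast]
      exact hn i hi
  constructor
  · rintro ⟨a, ha, b, hb, hab⟩
    dsimp only at hab
    rcases ha with ⟨i, hi, rfl⟩ | ha <;> rcases hb with ⟨j, hj, rfl⟩ | hb
    · have := hle i hi
      have := hle j hj
      omega
    · exact Or.inr (hmixed b hb i hi (by omega))
    · exact Or.inr (hmixed a ha j hj hab)
    · have := ha.2.1
      have := hb.2.1
      exact Or.inl (by omega)
  · rintro (h4 | ⟨j, hj, hmj, h⟩)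
    · obtain ⟨a, ha, b, hb, hab⟩ :=
        exists_add_eq_of_four_dvd h9 h25 (Nat.dvd_of_mod_eq_zero h4) (by omega)
      exact ⟨a, Or.inr ha, b, Or.inr hb, hab⟩
    · have h1 := hle j hj
      have h2 := hmod j hj
      obtain ⟨n, rfl⟩ : ∃ n, m = n + j * V := ⟨m - j * V, by omega⟩
      refine ⟨n, Or.inr ⟨by omega, by omega, fun i hi => ?_⟩, j * V, Or.inl ⟨j, hj, rfl⟩, rfl⟩
      have := h i hi
      rwa [hcast, Int.squarefree_natCast] at this

theorem isAlmostPeriodic_not_mem_extremalSet_add {V : ℕ} (hV : V % 4 = 1) (h9 : 3 ^ 2 ∣ V)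
    (h25 : 5 ^ 2 ∣ V) :
    IsAlmostPeriodic {m : ℕ | ¬ Squarefree m ∧ m ∉ extremalSet V + extremalSet V} := by
  have h1 : IsAlmostPeriodic {m : ℕ | m % 4 = 0 ∨ ∃ j ∈ Finset.Icc 1 3, m % 4 = j ∧
      ∀ i ∈ Finset.Icc (1 : ℕ) 3, ¬ Squarefree ((m : ℤ) + ((i : ℤ) - j) * V)} :=
    (isAlmostPeriodic_mod_four 0).union (IsAlmostPeriodic.exists_mem_finset _ fun j _ =>
      (isAlmostPeriodic_mod_four j).inter (IsAlmostPeriodic.forall_mem_finset _ fun i _ =>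
        IsAlmostPeriodic.not_squarefree_add _))
  refine ((IsAlmostPeriodic.not_squarefree_add 0).inter h1.compl).congr_of_forall_ge
    (6 * V + 2000) fun m hm => ?_
  refine and_congr ?_ (not_congr (mem_extremalSet_add_iff hV h9 h25 hm).symm)
  rw [Set.mem_ofPred_eq, add_zero, Int.squarefree_natCast]

/-! ### Densities of the extremal set and of the exceptions to its sumset -/

theorem sq_dvd_oddModulus {K q : ℕ} (hq : q.Prime) (h2 : q ≠ 2) (hK : q ≤ K) :
    q ^ 2 ∣ oddModulus K := by
  rw [oddModulus_eq_prod]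
  exact Finset.dvd_prod_of_mem (fun q : OddPrime K => q.1 ^ 2)
    (Finset.mem_univ (OddPrime.mk' K q hq h2 hK))

theorem oddModulus_mod_four (K : ℕ) : oddModulus K % 4 = 1 := by
  have h1 : oddModulus K = (∏ q : OddPrime K, q.1) ^ 2 := by
    rw [oddModulus_eq_prod, Finset.prod_pow]
  have h2 : Odd (∏ q : OddPrime K, q.1) := by
    refine Finset.prod_induction _ Odd (fun _ _ => Odd.mul) odd_one fun q _ => ?_
    exact q.prime.odd_of_ne_two q.ne_two
  obtain ⟨k, hk⟩ := h2
  rw [h1, hk]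
  ring_nf
  omega

/-- If q² divides m with q ≤ K odd, it divides V and hence every shift m + (i - j)V, so m lies in
the sumset; for q = 2, m is a large multiple of 4 and lies in it as well. -/
theorem exists_large_prime_of_not_mem_extremalSet_add {K m : ℕ} (hK : 7 ≤ K)
    (hm : 6 * oddModulus K + 2000 ≤ m) (hsq : ¬ Squarefree m)
    (hmem : m ∉ extremalSet (oddModulus K) + extremalSet (oddModulus K)) :
    ∃ q : ℕ, q.Prime ∧ K < q ∧ (q : ℤ) ^ 2 ∣ m + 0 := by
  have hV := oddModulus_mod_four K
  have h9 : 3 ^ 2 ∣ oddModulus K := sq_dvd_oddModulus (by norm_num) (by norm_num) (by omega)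
  have h25 : 5 ^ 2 ∣ oddModulus K := sq_dvd_oddModulus (by norm_num) (by norm_num) (by omega)
  rw [mem_extremalSet_add_iff hV h9 h25 hm] at hmem
  push Not at hmem
  rw [← Int.squarefree_natCast, Int.not_squarefree_iff_exists_prime] at hsq
  obtain ⟨q, hq, hqm⟩ := hsq
  refine ⟨q, hq, ?_, by rwa [add_zero]⟩
  by_contra hqK
  have hq2 : q ≠ 2 := by
    rintro rfl
    have : 2 ^ 2 ∣ m := by exact_mod_cast hqm
    exact hmem.1 (Nat.mod_eq_zero_of_dvd this)
  obtain ⟨i, -, hi⟩ := hmem.2 (m % 4) (Finset.mem_Icc.2 ⟨by have := hmem.1; omega, by omega⟩) rfl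
  refine Int.not_squarefree_iff_exists_prime.2 ⟨q, hq, dvd_add hqm (Dvd.dvd.mul_left ?_ _)⟩ hi
  have := sq_dvd_oddModulus hq hq2 (not_lt.1 hqK)
  exact_mod_cast this

theorem density_le_of_eventually {S : Set ℕ} {d η : ℝ} (hd : HasNatDensity S d)
    (h : ∀ᶠ N : ℕ in atTop, countUpTo S N ≤ η * N) : d ≤ η := by
  refine le_of_tendsto hd ?_
  filter_upwards [h, eventually_gt_atTop 0] with N hN hpos
  have hN' : (0 : ℝ) < N := by exact_mod_cast hpos
  rw [div_le_iff₀ hN']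
  exact hN

theorem le_density_of_eventually {S : Set ℕ} {d η : ℝ} (hd : HasNatDensity S d)
    (h : ∀ᶠ N : ℕ in atTop, η * N ≤ countUpTo S N) : η ≤ d := by
  refine ge_of_tendsto hd ?_
  filter_upwards [h, eventually_gt_atTop 0] with N hN hpos
  have hN' : (0 : ℝ) < N := by exact_mod_cast hpos
  rw [le_div_iff₀ hN']
  exact hN

theorem density_not_mem_extremalSet_add_le {K : ℕ} (hK : 7 ≤ K) {ε d : ℝ}
    (hKε : 2 * (K : ℝ)⁻¹ < ε)
    (hd : HasNatDensity {m : ℕ | ¬ Squarefree m ∧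
      m ∉ extremalSet (oddModulus K) + extremalSet (oddModulus K)} d) : d ≤ ε := by
  have hK0 : (0 : ℝ) < (K : ℝ)⁻¹ := by
    have : (0 : ℝ) < K := by exact_mod_cast (by omega : 0 < K)
    positivity
  refine density_le_of_eventually hd ?_
  filter_upwards [eventually_countUpTo_large_prime_sq_le (K := K) (by omega) 0
      (η := ε / 2) (by linarith),
    eventually_le_mul_natCast ((Set.Iio (6 * oddModulus K + 2000)).ncard : ℝ)
      (η := ε / 2) (by linarith)] with N h1 h2
  have h3 := countUpTo_union_le {n : ℕ | ∃ q : ℕ, q.Prime ∧ K < q ∧ (q : ℤ) ^ 2 ∣ n + 0}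
    (Set.Iio (6 * oddModulus K + 2000)) N
  have h4 := countUpTo_le_ncard (Set.finite_Iio (6 * oddModulus K + 2000)) N
  refine (countUpTo_mono (T := {n : ℕ | ∃ q : ℕ, q.Prime ∧ K < q ∧ (q : ℤ) ^ 2 ∣ n + 0} ∪
    Set.Iio (6 * oddModulus K + 2000)) fun m hm _ _ => ?_).trans (by linarith)
  by_cases hlt : m < 6 * oddModulus K + 2000
  · exact Or.inr hlt
  · exact Or.inl (exists_large_prime_of_not_mem_extremalSet_add hK (not_lt.1 hlt) hm.1 hm.2)

theorem card_filter_forall_ne_zero (K : ℕ) :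
    ((Finset.univ.filter fun g : OddResidues K => ∀ q, g q ≠ 0).card : ℝ) =
      oddModulus K * ∏ p ∈ oddPrimesUpTo K, (1 - 1 / (p : ℝ) ^ 2) := by
  have h1 : (Finset.univ.filter fun g : OddResidues K => ∀ q, g q ≠ 0) =
      Fintype.piFinset fun q : OddPrime K => (Finset.univ : Finset (ZMod (q.1 ^ 2))).erase 0 := by
    ext g
    simp [Fintype.mem_piFinset]
  rw [h1, Fintype.card_piFinset, oddModulus_eq_prod, ← Finset.prod_coe_sort (oddPrimesUpTo K)]
  push_cast
  rw [← Finset.prod_mul_distrib]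
  refine Finset.prod_congr rfl fun q _ => ?_
  have hpos : 0 < q.1 ^ 2 := pow_pos q.prime.pos 2
  have hne : (q.1 : ℝ) ≠ 0 := by exact_mod_cast q.prime.ne_zero
  rw [Finset.card_erase_of_mem (Finset.mem_univ _), Finset.card_univ, ZMod.card,
    Nat.cast_sub hpos]
  push_cast
  field_simp

/-- Every multiple of 4 divisible by some q² dividing V belongs to the set. Those divisible by none
fill a proportion equal to the product over the odd primes up to K. The loss 1 comes from rounding
N/4, and V from incomplete periods. -/
theorem le_countUpTo_extremalSet (K N : ℕ) :
    (1 - ∏ p ∈ oddPrimesUpTo K, (1 - 1 / (p : ℝ) ^ 2)) / 4 * N - (1 + oddModulus K) ≤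
      countUpTo (extremalSet (oddModulus K)) N := by
  classical
  set ρ := ∏ p ∈ oddPrimesUpTo K, (1 - 1 / (p : ℝ) ^ 2)
  have hρ1 : ρ ≤ 1 := Finset.prod_le_one
    (fun p hp => (one_sub_one_div_sq_pos (mem_oddPrimesUpTo.1 hp).2.1).le)
    fun p _ => one_sub_one_div_sq_le_one p
  have hV : (0 : ℝ) < oddModulus K := by exact_mod_cast oddModulus_pos K
  let D := (Finset.Icc 1 N).filter fun n => 4 ∣ n
  let U := D.filter fun n => ∀ q, oddResidue K n q ≠ 0
  have hU : (U.card : ℝ) ≤ ρ / 4 * N + oddModulus K := by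
    have hmaps : Set.MapsTo (oddResidue K) U
        (Finset.univ.filter fun g : OddResidues K => ∀ q, g q ≠ 0) := by
      intro n hn
      have := (Finset.mem_filter.1 hn).2
      simpa using this
    rw [Finset.card_eq_sum_card_fiberwise hmaps]
    push_cast
    refine (Finset.sum_le_card_nsmul _ _ (N / (4 * oddModulus K) + 1 : ℝ) ?_).trans ?_
    · intro g _
      have h1 := card_le_div_add_one_of_modEq (N := N) (L := 4 * oddModulus K)
        (S := U.filter fun n => oddResidue K n = g)
        (fun n hn => (Finset.mem_Icc.1 (Finset.mem_filter.1
          (Finset.mem_filter.1 (Finset.mem_filter.1 hn).1).1).1).2)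
        (fun n hn m hm => by
          have h4 : ∀ n ∈ U.filter fun n => oddResidue K n = g, (n : ZMod 4) = 0 := fun n hn =>
            (ZMod.natCast_eq_zero_iff _ _).2
              (Finset.mem_filter.1 (Finset.mem_filter.1 (Finset.mem_filter.1 hn).1).1).2
          exact modEq_oddModulus ((h4 n hn).trans (h4 m hm).symm)
            ((Finset.mem_filter.1 hn).2.trans (Finset.mem_filter.1 hm).2.symm))
      exact_mod_cast h1
    · rw [nsmul_eq_mul, card_filter_forall_ne_zero]
      have e : oddModulus K * ρ * (N / (4 * oddModulus K) + 1 : ℝ) =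
          ρ / 4 * N + oddModulus K * ρ := by
        field_simp
      rw [e]
      nlinarith
  have hD : (N : ℝ) / 4 - 1 ≤ D.card := by
    have h1 : N / 4 = D.card := by
      rw [← Nat.Ioc_filter_dvd_card_eq_div N 4]
      rfl
    rw [← h1]
    have h2 : (N : ℝ) ≤ 4 * (N / 4 : ℕ) + 4 := by
      exact_mod_cast (by omega : N ≤ 4 * (N / 4) + 4)
    linarith
  have hsub : ((D \ U).card : ℝ) ≤ countUpTo (extremalSet (oddModulus K)) N := by
    rw [countUpTo_eq_card]
    refine Nat.cast_le.2 (Finset.card_le_card fun n hn => ?_)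
    obtain ⟨hnD, hnU⟩ := Finset.mem_sdiff.1 hn
    obtain ⟨hnN, hn4⟩ := Finset.mem_filter.1 hnD
    refine Finset.mem_filter.2 ⟨hnN, Or.inr ?_⟩
    have hq : ∃ q, oddResidue K n q = 0 := by
      by_contra! hc
      exact hnU (Finset.mem_filter.2 ⟨hnD, hc⟩)
    obtain ⟨q, hq⟩ := hq
    exact mem_shiftedNonsquarefree_of_sq_dvd q.prime.one_lt
      (sq_dvd_oddModulus q.prime q.ne_two q.le) (Finset.mem_Icc.1 hnN).1 hn4
      ((ZMod.natCast_eq_zero_iff _ _).1 hq)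
  rw [Finset.cast_card_sdiff (Finset.filter_subset _ _)] at hsub
  linarith

/-- The extremal sets for the density bound `δ₀`. -/
theorem exists_extremal_set {ε : ℝ} (hε : 0 < ε) :
    ∃ A : Set ℕ, (∀ n ∈ A, 1 ≤ n) ∧
      (∃ d : ℝ, HasNatDensity A d ∧ delta0 - ε < d) ∧
      (∀ m ∈ A + A, ¬ Squarefree m) ∧
      (A + A + A)ᶜ.Finite ∧
      (∃ d : ℝ, HasNatDensity {m : ℕ | ¬ Squarefree m ∧ m ∉ A + A} d ∧ d ≤ ε) := by
  have hlim : ∀ᶠ K : ℕ in atTop,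
      ∏ p ∈ oddPrimesUpTo K, (1 - 1 / (p : ℝ) ^ 2) < 8 / Real.pi ^ 2 + ε :=
    tendsto_prod_oddPrimesUpTo.eventually_lt_const (by linarith)
  obtain ⟨K, hKρ, hK7, hKε⟩ := (hlim.and ((eventually_ge_atTop 7).and
    (eventually_le_mul_natCast 3 hε))).exists
  have hKpos : (0 : ℝ) < K := by exact_mod_cast (by omega : 0 < K)
  have hV := oddModulus_mod_four K
  have h9 : 3 ^ 2 ∣ oddModulus K := sq_dvd_oddModulus (by norm_num) (by norm_num) (by omega)
  have h25 : 5 ^ 2 ∣ oddModulus K := sq_dvd_oddModulus (by norm_num) (by norm_num) (by omega)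
  refine ⟨extremalSet (oddModulus K), ?_, ?_, not_squarefree_of_mem_extremalSet_add h9,
    finite_compl_extremalSet_add_add hV h9 h25, ?_⟩
  · rintro n (⟨i, hi, rfl⟩ | hn)
    · exact Nat.mul_pos (Finset.mem_Icc.1 hi).1 (oddModulus_pos K)
    · exact hn.1
  · obtain ⟨d, hd⟩ := (isAlmostPeriodic_extremalSet (oddModulus K)).exists_hasNatDensity
    refine ⟨d, hd, ?_⟩
    have h1 : delta0 - ε / 2 ≤ d := by
      refine le_density_of_eventually hd ?_
      filter_upwards [eventually_le_mul_natCast (1 + oddModulus K : ℝ)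
        (show 0 < ε / 4 by linarith)] with N hN
      have h2 := le_countUpTo_extremalSet K N
      have h3 : delta0 - ε / 4 ≤
          (1 - ∏ p ∈ oddPrimesUpTo K, (1 - 1 / (p : ℝ) ^ 2)) / 4 := by
        have : delta0 = (1 - 8 / Real.pi ^ 2) / 4 := by
          unfold delta0
          ring
        linarith
      have h4 := mul_le_mul_of_nonneg_right h3 (Nat.cast_nonneg (α := ℝ) N)
      linarith
    linarith
  · obtain ⟨d, hd⟩ :=
      (isAlmostPeriodic_not_mem_extremalSet_add hV h9 h25).exists_hasNatDensity
    refine ⟨d, hd, density_not_mem_extremalSet_add_le hK7 ?_ hd⟩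
    rw [← div_eq_mul_inv, div_lt_iff₀ hKpos]
    linarith

theorem theorem1 (ε : ℝ) (hε : 0 < ε) :
    (∃ x₀ : ℝ, ∀ x : ℝ, x₀ < x →
      (∀ A : Finset ℕ, (∀ n ∈ A, 1 ≤ n ∧ (n : ℝ) ≤ x) →
        (∀ m ∈ A + A, ¬ Squarefree m) →
        (delta1 + ε) * x < (A.card : ℝ) → IsOfTrivialType A) ∧
      (∀ A : Finset ℕ, (∀ n ∈ A, 1 ≤ n ∧ (n : ℝ) ≤ x) →
        (∀ m ∈ A + A, ¬ Squarefree m) →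
        (delta0 + ε) * x < (A.card : ℝ) → IsOfTrivialType A ∨ IsOfTwoClassType A)) ∧
    (∃ A : Set ℕ, (∀ n ∈ A, 1 ≤ n) ∧
      (∃ d : ℝ, HasNatDensity A d ∧ delta0 - ε < d) ∧
      (∀ m ∈ A + A, ¬ Squarefree m) ∧
      (A + A + A)ᶜ.Finite ∧
      (∃ d : ℝ, HasNatDensity {m : ℕ | ¬ Squarefree m ∧ m ∉ A + A} d ∧ d ≤ ε)) := by
  obtain ⟨x₁, h1⟩ := exists_forall_isOfTrivialType hε
  obtain ⟨x₂, h2⟩ := exists_forall_isOfTrivialType_or_isOfTwoClassType hε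
  exact ⟨⟨max x₁ x₂, fun x hx => ⟨h1 x ((le_max_left _ _).trans_lt hx),
    h2 x ((le_max_right _ _).trans_lt hx)⟩⟩, exists_extremal_set hε⟩
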